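/- Let $\beta>0$, $0<\nu\le 1$, $t>0$, and let $\lambda_1,\lambda_2,\dots\ge 0$ be pairwise distinct. A *fractional nonlinear birth process* of order $\nu$ with rates $\lambda_k$ is a counting process $\mathfrak N^\nu(s)\in\{1,2,\dots\}$, $s\ge 0$ (finite-valued, i.e. without explosion, with non-decreasing right-continuous paths), whose state probabilities $p_n(s)=\mathbb P(\mathfrak N^\nu(s)=n)$ are locally absolutely continuous and satisfy $$\frac{d^\nu p_n}{ds^\nu}=-\lambda_n p_n+\lambda_{n-1}p_{n-1}\quad(n\ge1,\ \text{a.e. } s>0),\qquad p_0\equiv 0,\quad p_n(0)=\delta_{n,1},$$ where $\frac{d^\nu f}{ds^\nu}(s)=\frac1{\Gamma(1-\nu)}\int_0^s\frac{f'(u)}{(s-u)^\nu}\,du$ is the Caputo derivative for $\nu<1$, and the ordinary derivative for $\nu=1$. Generalized Yule model: webpages appear according to a homogeneous Yule process of rate $\beta$, started from one webpage at time $0$ (the time spent with $j$ webpages is exponential with rate $\beta j$, independently for different $j$). From its creation on, the number of in-links of each webpage evolves as a fractional nonlinear birth process of order $\nu$ with rates $\lambda_k$ (so it starts with one in-link);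 these processes are independent of each other and of the process of webpages. Let ${}_t\mathfrak N^\nu$ be the number of in-links, at time $t$, of a webpage chosen uniformly at random (independently of everything else) among those created in $(0,t]$, given that at least one has been created. Let $\gamma(a,x)=\int_0^x e^{-u}u^{a-1}du$ and $\Gamma(a,x)=\int_x^\infty e^{-u}u^{a-1}du$; empty products are $1$. Then: 1. For every $n\ge 1$, the series below converge absolutely and $$\mathbb P({}_t\mathfrak N^\nu=n)=\frac{1}{1-e^{-\beta t}}\prod_{h=1}^{n-1}\lambda_h\sum_{m=1}^n\frac{1}{\prod_{l=1,\,l\ne m}^n(\lambda_l-\lambda_m)}\sum_{r=0}^\infty\frac{\gamma(\nu r+1,\beta t)}{\Gamma(\nu r+1)}\left(-\frac{\lambda_m}{\beta^\nu}\right)^r .$$ 2. For every $n\ge1$ such that $\lambda_m<\beta^\nu$ for $1\le m\le n$, the series below converge absolutely and $$\mathbb P({}_t\mathfrak N^\nu=n)=\frac{1}{1-e^{-\beta t}}\prod_{h=1}^{n-1}\lambda_h\sum_{m=1}^n\frac{1}{\prod_{l=1,\,l\ne m}^n(\lambda_l-\lambda_m)}\left[\frac{\beta^\nu}{\beta^\nu+\lambda_m}-\sum_{r=0}^\infty\frac{\Gamma(\nu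 r+1,\beta t)}{\Gamma(\nu r+1)}\left(-\frac{\lambda_m}{\beta^\nu}\right)^r\right].$$ 3. The power series $\sum_{r\ge0}\frac{\Gamma(\nu r+1,\beta t)}{\Gamma(\nu r+1)}z^r$ converges for $|z|<1$ and its sum extends to a holomorphic function $G$ on $\mathbb C\setminus\{1\}$; without any restriction on the sizes of the rates, for every $n\ge 1$, $$\mathbb P({}_t\mathfrak N^\nu=n)=\frac{1}{1-e^{-\beta t}}\prod_{h=1}^{n-1}\lambda_h\sum_{m=1}^n\frac{1}{\prod_{l=1,\,l\ne m}^n(\lambda_l-\lambda_m)}\left[\frac{\beta^\nu}{\beta^\nu+\lambda_m}-G\!\left(-\frac{\lambda_m}{\beta^\nu}\right)\right].$$ -/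

import Mathlib

open MeasureTheory ProbabilityTheory Set Filter
open scoped NNReal ENNReal

noncomputable section

/-- The lower incomplete gamma function `γ(a, x) = ∫₀ˣ e^{-u} u^{a-1} du`. -/
def lowerGamma (a x : ℝ) : ℝ :=
  ∫ u in (0 : ℝ)..x, Real.exp (-u) * u ^ (a - 1)

/-- The upper incomplete gamma function `Γ(a, x) = ∫ₓ^∞ e^{-u} u^{a-1} du`. -/
def upperGamma (a x : ℝ) : ℝ :=
  ∫ u in Ioi x, Real.exp (-u) * u ^ (a - 1)

/-- The Caputo derivative of order `ν ∈ (0, 1]` with base point `0`, of an (absolutely continuous)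
function on `[0, ∞)`; for `ν = 1` it is the ordinary derivative. -/
def caputoDeriv (ν : ℝ) (f : ℝ → ℝ) (t : ℝ) : ℝ :=
  if ν = 1 then deriv f t
  else 1 / Real.Gamma (1 - ν) * ∫ s in (0 : ℝ)..t, deriv f s / (t - s) ^ ν

section Processes

variable {Ω : Type*} [MeasurableSpace Ω]

/-- The state probability `p_n(s) = P(N(s) = n)`, as a function of the real variable `s ≥ 0`
(extended to negative `s` by its value at `0`). -/
def stateProb (P : Measure Ω) (N : ℝ≥0 → Ω → ℕ) (n : ℕ) (s : ℝ) : ℝ :=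
  P.real {ω | N s.toNNReal ω = n}

/-- `N` is a fractional nonlinear birth process of order `ν` with birth rates `lam 1, lam 2, …`
and one progenitor: a counting process with finite values (so that there is no explosion), whose
state probabilities `p_n`, `n ≥ 1`, are locally absolutely continuous and solve
`d^ν p_n / dt^ν = - lam n * p_n + lam (n-1) * p_{n-1}`, `p_n(0) = δ_{n,1}`, with `p_0 = 0`.
The value `lam 0` plays no role. -/
structure IsFractionalBirthProcess (ν : ℝ) (lam : ℕ → ℝ) (P : Measure Ω)
    (N : ℝ≥0 → Ω → ℕ) : Prop where
  measurable : ∀ s, Measurable (N s)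
  monotone : ∀ ω, Monotone fun s => N s ω
  right_continuous : ∀ ω s, ContinuousWithinAt (fun s => N s ω) (Ici s) s
  prob_zero : ∀ s : ℝ, 0 ≤ s → stateProb P N 0 s = 0
  initial : ∀ n : ℕ, 1 ≤ n → stateProb P N n 0 = if n = 1 then 1 else 0
  abs_cont : ∀ n : ℕ, 1 ≤ n → ∀ T : ℝ, 0 < T →
    AbsolutelyContinuousOnInterval (stateProb P N n) 0 T
  evolution : ∀ n : ℕ, 1 ≤ n → ∀ᵐ s ∂(volume.restrict (Ioi (0 : ℝ))),
    caputoDeriv ν (stateProb P N n) s =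
      - lam n * stateProb P N n s + lam (n - 1) * stateProb P N (n - 1) s

/-- The creation time of webpage number `k`, when `τ j` is the time during which exactly `j + 1`
webpages are present. Webpage `0` is the initial one, created at time `0`. -/
def creationTime (τ : ℕ → Ω → ℝ) (k : ℕ) (ω : Ω) : ℝ :=
  ∑ j ∈ Finset.range k, τ j ω

/-- The number of webpages created in `(0, t]`; together with the initial webpage there are
`newPages τ t ω + 1` webpages at time `t`. -/
def newPages (τ : ℕ → Ω → ℝ) (t : ℝ) (ω : Ω) : ℕ :=
  {k : ℕ | 1 ≤ k ∧ creationTime τ k ω ≤ t}.ncard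

/-- The generalized nonlinear Yule model. The webpages form a homogeneous Yule process of rate `β`:
the time `τ j` spent with `j + 1` webpages is exponential of rate `β (j + 1)`, and these times are
independent. From its creation on, the in-links of webpage `k` evolve as the process `N k`, where
the `N k` are fractional nonlinear birth processes, independent of each other and of the webpage
process. The random index `J k` is uniform on `{1, …, k}`; it serves to choose one among `k`
webpages uniformly at random, independently of everything else. -/
structure IsGeneralizedYuleModel (β ν : ℝ) (lam : ℕ → ℝ) (P : Measure Ω)
    (τ : ℕ → Ω → ℝ) (N : ℕ → ℝ≥0 → Ω → ℕ) (J : ℕ → Ω → ℕ) : Prop where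
  measurable_time : ∀ j, Measurable (τ j)
  law_time : ∀ j : ℕ, HasLaw (τ j) (expMeasure (β * ((j : ℝ) + 1))) P
  indep_time : iIndepFun τ P
  birth : ∀ k, IsFractionalBirthProcess ν lam P (N k)
  indep_birth : iIndepFun (fun (k : ℕ) (ω : Ω) (s : ℝ≥0) => N k s ω) P
  measurable_choice : ∀ k, Measurable (J k)
  law_choice : ∀ k : ℕ, 1 ≤ k → HasLaw (J k) (uniformOn (Icc 1 k)) P
  indep_time_choice : IndepFun (fun (ω : Ω) (j : ℕ) => τ j ω) (fun (ω : Ω) (k : ℕ) => J k ω) P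
  indep_birth_rest :
    IndepFun (fun (ω : Ω) (k : ℕ) (s : ℝ≥0) => N k s ω)
      (fun (ω : Ω) => ((fun j : ℕ => τ j ω), (fun k : ℕ => J k ω))) P

/-- The number of in-links, at time `t`, of a webpage chosen uniformly at random among those
created in `(0, t]` (meaningful when there is at least one). -/
def chosenSize (τ : ℕ → Ω → ℝ) (N : ℕ → ℝ≥0 → Ω → ℕ) (J : ℕ → Ω → ℕ) (t : ℝ) (ω : Ω) : ℕ :=
  N (J (newPages τ t ω) ω) (t - creationTime τ (J (newPages τ t ω) ω) ω).toNNReal ω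

/-- The distribution of the number of in-links, at time `t`, of a webpage chosen uniformly at
random among those created in `(0, t]`, given that there is at least one. -/
def sizeProb (P : Measure Ω) (τ : ℕ → Ω → ℝ) (N : ℕ → ℝ≥0 → Ω → ℕ) (J : ℕ → Ω → ℕ)
    (t : ℝ) (n : ℕ) : ℝ :=
  (cond P {ω | 1 ≤ newPages τ t ω}).real {ω | chosenSize τ N J t ω = n}

end Processes

end

/-!
Integrated `ν` times in the sense of Riemann and Liouville, the fractional birth equations become
triangular Volterra equations, which have a unique continuous solution: a partial-fraction
combination of Mittag-Leffler functions `E_ν(-λ_m s ^ ν)`, `m ≤ n`. On the side of the webpages,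
splitting a path of the Yule process at its `i`-th birth and summing over `i` shows that, given the
number of births in `(0, t]`, the age at time `t` of a uniformly chosen new page has the truncated
exponential density `β e^{-βs} / (1 - e^{-βt})` on `[0, t]`, whatever that number is. The ages are
independent of the in-links, so the law of the chosen size is the mixture of the birth
probabilities over this density. Integrating the Mittag-Leffler series term by term produces the
lower incomplete gamma functions. Since `γ(a, x) + Γ(a, x) = Γ(a)`, the series splits for small
rates into a geometric series minus the series of the `Γ(νr + 1, βt)`; the lower series being
entire, the same identity continues the upper one to `ℂ ∖ {1}`.
-/

section IncompleteGamma

variable {a x : ℝ}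

lemma integrableOn_exp_neg_mul_rpow (ha : 0 < a) :
    IntegrableOn (fun u : ℝ => Real.exp (-u) * u ^ (a - 1)) (Ioi 0) :=
  Real.GammaIntegral_convergent ha

lemma lowerGamma_add_upperGamma (ha : 0 < a) (hx : 0 ≤ x) :
    lowerGamma a x + upperGamma a x = Real.Gamma a := by
  have hint := integrableOn_exp_neg_mul_rpow ha
  rw [Real.Gamma_eq_integral ha, lowerGamma, upperGamma, intervalIntegral.integral_of_le hx,
    ← setIntegral_union (Ioc_disjoint_Ioi le_rfl) measurableSet_Ioi
      (hint.mono_set Ioc_subset_Ioi_self) (hint.mono_set (Ioi_subset_Ioi hx)),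
    Ioc_union_Ioi_eq_Ioi hx]

lemma lowerGamma_nonneg (hx : 0 ≤ x) : 0 ≤ lowerGamma a x :=
  intervalIntegral.integral_nonneg hx fun _ hu =>
    mul_nonneg (Real.exp_nonneg _) (Real.rpow_nonneg hu.1 _)

lemma upperGamma_nonneg (hx : 0 ≤ x) : 0 ≤ upperGamma a x :=
  setIntegral_nonneg measurableSet_Ioi fun _ hu =>
    mul_nonneg (Real.exp_nonneg _) (Real.rpow_nonneg (hx.trans (le_of_lt hu)) _)

lemma lowerGamma_le_rpow_mul (ha : 1 ≤ a) (hx : 0 ≤ x) :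
    lowerGamma a x ≤ x ^ (a - 1) * x := by
  have hbound : ∀ u ∈ uIoc 0 x, ‖Real.exp (-u) * u ^ (a - 1)‖ ≤ x ^ (a - 1) := fun u hu => by
    rw [uIoc_of_le hx] at hu
    have hpow : 0 ≤ u ^ (a - 1) := Real.rpow_nonneg hu.1.le _
    rw [Real.norm_of_nonneg (mul_nonneg (Real.exp_nonneg _) hpow)]
    exact (mul_le_of_le_one_left hpow (Real.exp_le_one_iff.2 (neg_nonpos.2 hu.1.le))).trans
      (Real.rpow_le_rpow hu.1.le hu.2 (sub_nonneg.2 ha))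
  have h := intervalIntegral.norm_integral_le_of_norm_le_const hbound
  rw [sub_zero, abs_of_nonneg hx] at h
  exact (le_abs_self _).trans h

lemma rpow_mul_exp_neg_le_upperGamma (ha : 0 ≤ a) (hx : 0 ≤ x) :
    x ^ a * Real.exp (-x) ≤ upperGamma (a + 1) x := by
  rw [← integral_exp_neg_Ioi x, ← integral_const_mul, upperGamma]
  refine setIntegral_mono_on ((integrableOn_exp_neg_Ioi x).const_mul (x ^ a))
    ((integrableOn_exp_neg_mul_rpow (by linarith)).mono_set (Ioi_subset_Ioi hx))
    measurableSet_Ioi fun u hu => ?_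
  rw [mul_comm, add_sub_cancel_right]
  exact mul_le_mul_of_nonneg_left (Real.rpow_le_rpow hx (le_of_lt hu) ha) (Real.exp_nonneg _)

lemma rpow_mul_exp_neg_le_Gamma (ha : 0 ≤ a) (hx : 0 ≤ x) :
    x ^ a * Real.exp (-x) ≤ Real.Gamma (a + 1) :=
  (rpow_mul_exp_neg_le_upperGamma ha hx).trans <|
    (le_add_of_nonneg_left (lowerGamma_nonneg hx)).trans
      (lowerGamma_add_upperGamma (by linarith) hx).le

lemma lowerGamma_div_Gamma (ha : 0 < a) (hx : 0 ≤ x) :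
    lowerGamma a x / Real.Gamma a = 1 - upperGamma a x / Real.Gamma a := by
  rw [eq_sub_iff_add_eq, ← add_div, lowerGamma_add_upperGamma ha hx,
    div_self (Real.Gamma_pos_of_pos ha).ne']

lemma upperGamma_div_Gamma_mem_Icc (ha : 0 < a) (hx : 0 ≤ x) :
    upperGamma a x / Real.Gamma a ∈ Icc (0 : ℝ) 1 := by
  have hΓ := Real.Gamma_pos_of_pos ha
  have hlower : 0 ≤ lowerGamma a x / Real.Gamma a := div_nonneg (lowerGamma_nonneg hx) hΓ.le
  rw [lowerGamma_div_Gamma ha hx] at hlower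
  exact ⟨div_nonneg (upperGamma_nonneg hx) hΓ.le, sub_nonneg.1 hlower⟩

end IncompleteGamma

section PowerSeries

lemma differentiable_tsum_mul_pow {a : ℕ → ℂ} (ha : ∀ z : ℂ, Summable fun r => a r * z ^ r) :
    Differentiable ℂ fun z : ℂ => ∑' r : ℕ, a r * z ^ r := by
  intro z
  have hball : DifferentiableOn ℂ (fun w : ℂ => ∑' r : ℕ, a r * w ^ r)
      (Metric.ball 0 (‖z‖ + 1)) := by
    refine Complex.differentiableOn_tsum_of_summable_norm (ha ((‖z‖ + 1 : ℝ) : ℂ)).norm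
      (fun r => by fun_prop) Metric.isOpen_ball fun r w hw => ?_
    rw [mem_ball_zero_iff] at hw
    rw [norm_mul, norm_mul, norm_pow, norm_pow, Complex.norm_of_nonneg (by positivity)]
    gcongr
  exact (hball z (by simp)).differentiableAt (Metric.isOpen_ball.mem_nhds (by simp))

variable {a : ℕ → ℝ} (ha : ∀ z : ℝ, Summable fun r => a r * z ^ r)
include ha

lemma summable_ofReal_mul_pow (z : ℂ) : Summable fun r => (a r : ℂ) * z ^ r := by
  refine (ha ‖z‖).norm.of_norm_bounded fun r => ?_
  rw [norm_mul, norm_mul, norm_pow, norm_pow, Complex.norm_real, norm_norm]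

lemma continuous_tsum_mul_pow : Continuous fun z : ℝ => ∑' r : ℕ, a r * z ^ r := by
  have h := Complex.continuous_re.comp ((differentiable_tsum_mul_pow
    (summable_ofReal_mul_pow ha)).continuous.comp Complex.continuous_ofReal)
  refine h.congr fun z => ?_
  rw [Function.comp_apply, Function.comp_apply, ← Complex.ofReal_re (∑' r : ℕ, a r * z ^ r),
    Complex.ofReal_tsum]
  simp only [Complex.ofReal_mul, Complex.ofReal_pow]

lemma hasSum_intervalIntegral_mul_pow {k φ : ℝ → ℝ} {T : ℝ}
    (hk : IntervalIntegrable k volume 0 T) (hφ : Continuous φ) :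
    HasSum (fun r : ℕ => ∫ s in (0 : ℝ)..T, k s * (a r * φ s ^ r))
      (∫ s in (0 : ℝ)..T, k s * ∑' r : ℕ, a r * φ s ^ r) := by
  obtain ⟨B, hB⟩ := (isCompact_uIcc (a := (0 : ℝ)) (b := T)).exists_bound_of_continuousOn
    hφ.continuousOn
  refine intervalIntegral.hasSum_integral_of_dominated_convergence
    (fun r s => ‖k s‖ * ‖a r * B ^ r‖)
    (fun r => hk.def'.aestronglyMeasurable.mul
      ((hφ.pow r).const_mul (a r)).measurable.aestronglyMeasurable)
    (fun r => ae_of_all _ fun s hs => ?_) (ae_of_all _ fun s _ => (ha B).norm.mul_left _)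
    ?_ (ae_of_all _ fun s _ => (ha (φ s)).hasSum.mul_left _)
  · rw [norm_mul, norm_mul (a r), norm_mul (a r), norm_pow, norm_pow]
    have hφB : ‖φ s‖ ≤ ‖B‖ := (hB s (uIoc_subset_uIcc hs)).trans (le_abs_self B)
    gcongr
  · simp_rw [tsum_mul_left]
    exact hk.norm.mul_const _

end PowerSeries

section GammaSeries

variable {ν x z : ℝ}

lemma summable_inv_Gamma_mul_pow (hν : 0 < ν) (z : ℝ) :
    Summable fun r : ℕ => (Real.Gamma (ν * r + 1))⁻¹ * z ^ r := by
  obtain ⟨M, hM, hMν⟩ : ∃ M : ℝ, 0 < M ∧ M ^ ν = 2 * (|z| + 1) :=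
    ⟨(2 * (|z| + 1)) ^ ν⁻¹, by positivity, Real.rpow_inv_rpow (by positivity) hν.ne'⟩
  refine (summable_geometric_two.mul_left (Real.exp M)).of_norm_bounded fun r => ?_
  have hΓ : 0 < Real.Gamma (ν * r + 1) := Real.Gamma_pos_of_pos (by positivity)
  have hle : (2 * (|z| + 1)) ^ r * Real.exp (-M) ≤ Real.Gamma (ν * r + 1) := by
    rw [← hMν, ← Real.rpow_natCast, ← Real.rpow_mul hM.le]
    exact rpow_mul_exp_neg_le_Gamma (by positivity) hM.le
  rw [norm_mul, norm_inv, norm_pow, Real.norm_of_nonneg hΓ.le, Real.norm_eq_abs,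
    inv_mul_le_iff₀ hΓ]
  calc |z| ^ r ≤ (|z| + 1) ^ r := by gcongr; linarith
    _ = ((2 * (|z| + 1)) ^ r * Real.exp (-M)) * (Real.exp M * (1 / 2) ^ r) := by
        rw [mul_pow, Real.exp_neg, one_div, inv_pow]
        field_simp
    _ ≤ Real.Gamma (ν * r + 1) * (Real.exp M * (1 / 2) ^ r) := by gcongr

lemma summable_lowerGamma_div_Gamma_mul_pow (hν : 0 < ν) (hx : 0 ≤ x) (z : ℝ) :
    Summable fun r : ℕ => lowerGamma (ν * r + 1) x / Real.Gamma (ν * r + 1) * z ^ r := by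
  refine ((summable_inv_Gamma_mul_pow hν (x ^ ν * |z|)).mul_left x).of_norm_bounded fun r => ?_
  have hΓ : 0 < Real.Gamma (ν * r + 1) := Real.Gamma_pos_of_pos (by positivity)
  have hle : lowerGamma (ν * r + 1) x ≤ (x ^ ν) ^ r * x := by
    have h := lowerGamma_le_rpow_mul (a := ν * r + 1) (le_add_of_nonneg_left (by positivity)) hx
    rwa [add_sub_cancel_right, Real.rpow_mul hx, Real.rpow_natCast] at h
  rw [norm_mul, norm_pow, Real.norm_of_nonneg (div_nonneg (lowerGamma_nonneg hx) hΓ.le),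
    Real.norm_eq_abs, mul_pow, div_mul_eq_mul_div, div_le_iff₀ hΓ]
  calc lowerGamma (ν * r + 1) x * |z| ^ r ≤ (x ^ ν) ^ r * x * |z| ^ r := by gcongr
    _ = x * ((Real.Gamma (ν * r + 1))⁻¹ * ((x ^ ν) ^ r * |z| ^ r)) * Real.Gamma (ν * r + 1) := by
        field_simp

lemma summable_upperGamma_div_Gamma_mul_pow (hν : 0 ≤ ν) (hx : 0 ≤ x) (hz : |z| < 1) :
    Summable fun r : ℕ => upperGamma (ν * r + 1) x / Real.Gamma (ν * r + 1) * z ^ r := by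
  refine (summable_geometric_of_lt_one (abs_nonneg z) hz).of_norm_bounded fun r => ?_
  have h := upperGamma_div_Gamma_mem_Icc (a := ν * r + 1) (by positivity) hx
  rw [norm_mul, norm_pow, Real.norm_of_nonneg h.1, Real.norm_eq_abs]
  exact mul_le_of_le_one_left (by positivity) h.2

lemma tsum_lowerGamma_div_Gamma_mul_pow (hν : 0 ≤ ν) (hx : 0 ≤ x) (hz : |z| < 1) :
    ∑' r : ℕ, lowerGamma (ν * r + 1) x / Real.Gamma (ν * r + 1) * z ^ r =
      (1 - z)⁻¹ - ∑' r : ℕ, upperGamma (ν * r + 1) x / Real.Gamma (ν * r + 1) * z ^ r := by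
  rw [← tsum_geometric_of_abs_lt_one hz, ← (summable_geometric_of_abs_lt_one hz).tsum_sub
    (summable_upperGamma_div_Gamma_mul_pow hν hx hz)]
  refine tsum_congr fun r => ?_
  rw [lowerGamma_div_Gamma (by positivity) hx, sub_mul, one_mul]

/-- The analytic continuation to `ℂ ∖ {1}` of `∑ Γ(ν r + 1, x) / Γ(ν r + 1) z ^ r`: replacing
`Γ(a, x)` by `Γ(a) - γ(a, x)` splits the series into a geometric one and an entire one. -/
noncomputable def upperGammaContinuation (ν x : ℝ) (z : ℂ) : ℂ :=
  (1 - z)⁻¹ - ∑' r : ℕ,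
    ((lowerGamma (ν * r + 1) x / Real.Gamma (ν * r + 1) : ℝ) : ℂ) * z ^ r

lemma differentiableOn_upperGammaContinuation (hν : 0 < ν) (hx : 0 ≤ x) :
    DifferentiableOn ℂ (upperGammaContinuation ν x) {1}ᶜ := by
  refine DifferentiableOn.sub (DifferentiableOn.inv (by fun_prop) fun z hz => ?_)
    (differentiable_tsum_mul_pow (summable_ofReal_mul_pow
      (summable_lowerGamma_div_Gamma_mul_pow hν hx))).differentiableOn
  exact sub_ne_zero.2 (Ne.symm hz)

lemma hasSum_upperGammaContinuation (hν : 0 < ν) (hx : 0 ≤ x) {z : ℂ} (hz : ‖z‖ < 1) :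
    HasSum (fun r : ℕ => ((upperGamma (ν * r + 1) x / Real.Gamma (ν * r + 1) : ℝ) : ℂ) * z ^ r)
      (upperGammaContinuation ν x z) := by
  have hlower := summable_ofReal_mul_pow (summable_lowerGamma_div_Gamma_mul_pow hν hx) z
  refine ((hasSum_geometric_of_norm_lt_one hz).sub hlower.hasSum).congr_fun fun r => ?_
  rw [lowerGamma_div_Gamma (by positivity) hx]
  push_cast
  ring

lemma ofReal_tsum_lowerGamma_div_Gamma_mul_pow (ν x z : ℝ) :
    ((∑' r : ℕ, lowerGamma (ν * r + 1) x / Real.Gamma (ν * r + 1) * z ^ r : ℝ) : ℂ) =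
      (((1 - z)⁻¹ : ℝ) : ℂ) - upperGammaContinuation ν x z := by
  simp only [upperGammaContinuation, Complex.ofReal_tsum, Complex.ofReal_mul, Complex.ofReal_pow,
    Complex.ofReal_inv, Complex.ofReal_sub, Complex.ofReal_one, sub_sub_cancel]

end GammaSeries

section FractionalCalculus

/-- The kernel `x ^ (ν - 1) / Γ(ν)` of fractional integration of order `ν`, extended by `0` to
`x ≤ 0`, so that fractional integrals are convolutions with it. -/
noncomputable def rlKernel (ν x : ℝ) : ℝ :=
  (Ioi 0).indicator (fun x => x ^ (ν - 1) / Real.Gamma ν) x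

/-- The Riemann–Liouville fractional integral of order `ν` with base point `0`, evaluated at
`t ≥ 0`. -/
noncomputable def rlIntegral (ν : ℝ) (f : ℝ → ℝ) (t : ℝ) : ℝ :=
  ∫ s in (0 : ℝ)..t, rlKernel ν (t - s) * f s

variable {μ ν t u x : ℝ}

lemma rlKernel_of_pos (ν : ℝ) (hx : 0 < x) : rlKernel ν x = x ^ (ν - 1) / Real.Gamma ν :=
  indicator_of_mem hx _

lemma rlKernel_of_nonpos (ν : ℝ) (hx : x ≤ 0) : rlKernel ν x = 0 :=
  indicator_of_notMem (notMem_Ioi.2 hx) _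

lemma rlKernel_pos (hν : 0 < ν) (hx : 0 < x) : 0 < rlKernel ν x := by
  rw [rlKernel_of_pos ν hx]
  exact div_pos (Real.rpow_pos_of_pos hx _) (Real.Gamma_pos_of_pos hν)

lemma rlKernel_nonneg (hν : 0 < ν) (x : ℝ) : 0 ≤ rlKernel ν x := by
  rcases le_or_gt x 0 with hx | hx
  · exact (rlKernel_of_nonpos ν hx).ge
  · exact (rlKernel_pos hν hx).le

lemma rlKernel_one (hx : 0 < x) : rlKernel 1 x = 1 := by
  rw [rlKernel_of_pos 1 hx, sub_self, Real.rpow_zero, Real.Gamma_one, div_one]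

@[fun_prop]
lemma measurable_rlKernel (ν : ℝ) : Measurable (rlKernel ν) :=
  ((measurable_id.pow_const _).div_const _).indicator measurableSet_Ioi

lemma integral_rpow_mul_sub_rpow (hμ : 0 < μ) (hν : 0 < ν) (ht : 0 < t) :
    ∫ s in (0 : ℝ)..t, s ^ (μ - 1) * (t - s) ^ (ν - 1) =
      t ^ (μ + ν - 1) * (Real.Gamma μ * Real.Gamma ν / Real.Gamma (μ + ν)) := by
  have hcast : ∫ s : ℝ in (0 : ℝ)..t, (s : ℂ) ^ ((μ : ℂ) - 1) * ((t : ℂ) - s) ^ ((ν : ℂ) - 1) =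
      ((∫ s in (0 : ℝ)..t, s ^ (μ - 1) * (t - s) ^ (ν - 1) : ℝ) : ℂ) := by
    rw [← intervalIntegral.integral_ofReal]
    refine intervalIntegral.integral_congr fun s hs => ?_
    rw [uIcc_of_le ht.le] at hs
    rw [Complex.ofReal_mul, Complex.ofReal_cpow (sub_nonneg.2 hs.2), Complex.ofReal_cpow hs.1]
    push_cast
    rfl
  have hbeta := Complex.betaIntegral_scaled μ ν ht
  rw [Complex.betaIntegral_eq_Gamma_mul_div _ _ (by simpa) (by simpa), hcast] at hbeta
  apply Complex.ofReal_injective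
  rw [hbeta]
  push_cast [Complex.ofReal_cpow ht.le, ← Complex.Gamma_ofReal]
  rfl

lemma rlKernel_sub_mul_rlKernel_sub_eq_zero {s : ℝ} (μ ν : ℝ) (hs : s ∉ Ioo u t) :
    rlKernel μ (t - s) * rlKernel ν (s - u) = 0 := by
  rcases lt_or_ge u s with hus | hus
  · rw [rlKernel_of_nonpos μ (sub_nonpos.2 (not_lt.1 fun hst => hs ⟨hus, hst⟩)), zero_mul]
  · rw [rlKernel_of_nonpos ν (sub_nonpos.2 hus), mul_zero]

lemma integral_rlKernel_sub_mul_rlKernel_sub (hμ : 0 < μ) (hν : 0 < ν) (t u : ℝ) :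
    ∫ s, rlKernel μ (t - s) * rlKernel ν (s - u) = rlKernel (μ + ν) (t - u) := by
  rw [← setIntegral_eq_integral_of_forall_compl_eq_zero fun s hs =>
    rlKernel_sub_mul_rlKernel_sub_eq_zero μ ν hs]
  rcases le_or_gt t u with htu | hut
  · rw [Ioo_eq_empty htu.not_gt, setIntegral_empty, rlKernel_of_nonpos _ (sub_nonpos.2 htu)]
  have hcongr : EqOn (fun s => rlKernel μ (t - s) * rlKernel ν (s - u))
      (fun s => (Real.Gamma μ * Real.Gamma ν)⁻¹ *
        ((s - u) ^ (ν - 1) * (t - u - (s - u)) ^ (μ - 1))) (Ioo u t) := fun s hs => by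
    simp only [rlKernel_of_pos _ (sub_pos.2 hs.1), rlKernel_of_pos _ (sub_pos.2 hs.2),
      sub_sub_sub_cancel_right]
    field_simp
  have hμΓ := (Real.Gamma_pos_of_pos hμ).ne'
  have hνΓ := (Real.Gamma_pos_of_pos hν).ne'
  rw [setIntegral_congr_fun measurableSet_Ioo hcongr, ← integral_Ioc_eq_integral_Ioo,
    ← intervalIntegral.integral_of_le hut.le, intervalIntegral.integral_const_mul,
    intervalIntegral.integral_comp_sub_right
      (fun s => s ^ (ν - 1) * (t - u - s) ^ (μ - 1)) u, sub_self,
    integral_rpow_mul_sub_rpow hν hμ (sub_pos.2 hut), rlKernel_of_pos _ (sub_pos.2 hut),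
    add_comm ν μ]
  field_simp

lemma integrable_rlKernel_sub_mul_rlKernel_sub (hμ : 0 < μ) (hν : 0 < ν) (t u : ℝ) :
    Integrable fun s => rlKernel μ (t - s) * rlKernel ν (s - u) := by
  rcases le_or_gt t u with htu | hut
  · refine (integrable_zero ℝ ℝ volume).congr (ae_of_all _ fun s => ?_)
    exact (rlKernel_sub_mul_rlKernel_sub_eq_zero μ ν (Ioo_eq_empty htu.not_gt ▸ id)).symm
  · refine of_not_not fun hcon => (rlKernel_pos (add_pos hμ hν) (sub_pos.2 hut)).ne ?_
    rw [← integral_rlKernel_sub_mul_rlKernel_sub hμ hν, integral_undef hcon]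

lemma intervalIntegrable_rlKernel_sub (hν : 0 < ν) (t : ℝ) :
    IntervalIntegrable (fun s => rlKernel ν (t - s)) volume 0 t := by
  have h := (intervalIntegral.intervalIntegrable_rpow' (a := 0) (b := t) (r := ν - 1)
    (by linarith)).div_const (Real.Gamma ν)
  have hker : IntervalIntegrable (rlKernel ν) volume 0 t := by
    rw [intervalIntegrable_iff] at h ⊢
    exact (h.indicator measurableSet_Ioi).congr (ae_of_all _ fun _ => rfl)
  simpa only [sub_zero, sub_self] using (hker.comp_sub_left t).symm

lemma intervalIntegrable_rlKernel_sub_mul (hν : 0 < ν) {f : ℝ → ℝ} (hf : Continuous f) (t : ℝ) :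
    IntervalIntegrable (fun s => rlKernel ν (t - s) * f s) volume 0 t :=
  (intervalIntegrable_rlKernel_sub hν t).mul_continuousOn hf.continuousOn

lemma rlIntegral_eq_setIntegral_Ioi (ν : ℝ) (f : ℝ → ℝ) (ht : 0 ≤ t) :
    rlIntegral ν f t = ∫ s in Ioi 0, rlKernel ν (t - s) * f s := by
  rw [rlIntegral, intervalIntegral.integral_of_le ht]
  refine (setIntegral_eq_of_subset_of_forall_sdiff_eq_zero measurableSet_Ioi Ioc_subset_Ioi_self
    fun s hs => ?_).symm
  rw [rlKernel_of_nonpos ν (sub_nonpos.2 (not_le.1 fun hst => hs.2 ⟨hs.1, hst⟩).le), zero_mul]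

lemma rlIntegral_one (f : ℝ → ℝ) (ht : 0 ≤ t) : rlIntegral 1 f t = ∫ s in (0 : ℝ)..t, f s := by
  rw [rlIntegral, intervalIntegral.integral_of_le ht, intervalIntegral.integral_of_le ht,
    integral_Ioc_eq_integral_Ioo, integral_Ioc_eq_integral_Ioo]
  refine setIntegral_congr_fun measurableSet_Ioo fun s hs => ?_
  simp only [rlKernel_one (sub_pos.2 hs.2), one_mul]

lemma rlIntegral_congr_ae {f g : ℝ → ℝ} (ht : 0 ≤ t)
    (h : ∀ᵐ s ∂(volume.restrict (Ioi (0 : ℝ))), f s = g s) :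
    rlIntegral ν f t = rlIntegral ν g t := by
  rw [rlIntegral_eq_setIntegral_Ioi ν f ht, rlIntegral_eq_setIntegral_Ioi ν g ht]
  exact integral_congr_ae (h.mono fun s hs => by simp only [hs])

lemma rlIntegral_congr {f g : ℝ → ℝ} (ht : 0 ≤ t) (h : ∀ s, 0 ≤ s → f s = g s) :
    rlIntegral ν f t = rlIntegral ν g t :=
  rlIntegral_congr_ae ht <| (ae_restrict_mem measurableSet_Ioi).mono fun s hs => h s (le_of_lt hs)

lemma rlIntegral_const_mul (ν c : ℝ) (f : ℝ → ℝ) (t : ℝ) :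
    rlIntegral ν (fun s => c * f s) t = c * rlIntegral ν f t := by
  simp only [rlIntegral, mul_left_comm _ c, intervalIntegral.integral_const_mul]

lemma rlIntegral_add (hν : 0 < ν) {f g : ℝ → ℝ} (hf : Continuous f) (hg : Continuous g) (t : ℝ) :
    rlIntegral ν (fun s => f s + g s) t = rlIntegral ν f t + rlIntegral ν g t := by
  simp only [rlIntegral, mul_add]
  exact intervalIntegral.integral_add (intervalIntegrable_rlKernel_sub_mul hν hf t)
    (intervalIntegrable_rlKernel_sub_mul hν hg t)

lemma rlIntegral_sum (hν : 0 < ν) {ι : Type*} (S : Finset ι) {f : ι → ℝ → ℝ}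
    (hf : ∀ i, Continuous (f i)) (t : ℝ) :
    rlIntegral ν (fun s => ∑ i ∈ S, f i s) t = ∑ i ∈ S, rlIntegral ν (f i) t := by
  simp only [rlIntegral, Finset.mul_sum]
  exact intervalIntegral.integral_finsetSum fun i _ =>
    intervalIntegrable_rlKernel_sub_mul hν (hf i) t

lemma abs_rlIntegral_le (hν : 0 < ν) (ht : 0 ≤ t) {f g : ℝ → ℝ} (hg : Continuous g)
    (h : ∀ s ∈ Icc 0 t, |f s| ≤ g s) : |rlIntegral ν f t| ≤ rlIntegral ν g t := by
  rw [← Real.norm_eq_abs]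
  refine intervalIntegral.norm_integral_le_of_norm_le ht (ae_of_all _ fun s hs => ?_)
    (intervalIntegrable_rlKernel_sub_mul hν hg t)
  rw [norm_mul, Real.norm_of_nonneg (rlKernel_nonneg hν _)]
  exact mul_le_mul_of_nonneg_left (h s ⟨hs.1.le, hs.2⟩) (rlKernel_nonneg hν _)

lemma rlIntegral_rlKernel (hμ : 0 < μ) (hν : 0 < ν) (ht : 0 ≤ t) :
    rlIntegral μ (rlKernel ν) t = rlKernel (μ + ν) t := by
  have h := integral_rlKernel_sub_mul_rlKernel_sub hμ hν t 0
  rw [← setIntegral_eq_integral_of_forall_compl_eq_zero (s := Ioi 0) fun s hs =>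
    rlKernel_sub_mul_rlKernel_sub_eq_zero μ ν fun hst => hs hst.1] at h
  simpa only [rlIntegral_eq_setIntegral_Ioi μ _ ht, sub_zero] using h

lemma rlIntegral_rpow_div_Gamma {a : ℝ} (hν : 0 < ν) (ha : 0 ≤ a) (ht : 0 ≤ t) :
    rlIntegral ν (fun s => s ^ a / Real.Gamma (a + 1)) t =
      t ^ (a + ν) / Real.Gamma (a + ν + 1) := by
  rcases ht.eq_or_lt with rfl | ht
  · rw [rlIntegral, intervalIntegral.integral_same, Real.zero_rpow (by positivity), zero_div]
  have hker : ∀ᵐ s ∂(volume.restrict (Ioi (0 : ℝ))),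
      s ^ a / Real.Gamma (a + 1) = rlKernel (a + 1) s := by
    filter_upwards [ae_restrict_mem measurableSet_Ioi] with s hs
    rw [rlKernel_of_pos _ hs, add_sub_cancel_right]
  rw [rlIntegral_congr_ae ht.le hker, rlIntegral_rlKernel hν (by positivity) ht.le,
    rlKernel_of_pos _ ht, show ν + (a + 1) = a + ν + 1 by ring, add_sub_cancel_right]

lemma integrable_rlKernel_mul_rlKernel_mul (hμ : 0 < μ) (hν : 0 < ν) {f : ℝ → ℝ}
    (hf : Measurable f)
    (hint : IntegrableOn (fun u => rlKernel (μ + ν) (t - u) * f u) (Ioi 0)) :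
    Integrable (fun p : ℝ × ℝ => rlKernel μ (t - p.1) * rlKernel ν (p.1 - p.2) * f p.2)
      (volume.prod (volume.restrict (Ioi 0))) := by
  have hmeas : Measurable fun p : ℝ × ℝ =>
      rlKernel μ (t - p.1) * rlKernel ν (p.1 - p.2) * f p.2 := by fun_prop
  rw [integrable_prod_iff' hmeas.aestronglyMeasurable]
  refine ⟨ae_of_all _ fun u =>
    (integrable_rlKernel_sub_mul_rlKernel_sub hμ hν t u).mul_const (f u), ?_⟩
  refine hint.norm.congr (ae_of_all _ fun u => ?_)
  simp only [norm_mul, Real.norm_of_nonneg (rlKernel_nonneg hμ _),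
    Real.norm_of_nonneg (rlKernel_nonneg hν _),
    Real.norm_of_nonneg (rlKernel_nonneg (add_pos hμ hν) _)]
  rw [integral_mul_const, integral_rlKernel_sub_mul_rlKernel_sub hμ hν]

theorem rlIntegral_rlIntegral (hμ : 0 < μ) (hν : 0 < ν) (ht : 0 ≤ t) {f : ℝ → ℝ}
    (hf : Measurable f)
    (hint : IntegrableOn (fun u => rlKernel (μ + ν) (t - u) * f u) (Ioi 0)) :
    rlIntegral μ (rlIntegral ν f) t = rlIntegral (μ + ν) f t := by
  have hinner : ∀ s, 0 < s → rlKernel μ (t - s) * rlIntegral ν f s =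
      ∫ u in Ioi 0, rlKernel μ (t - s) * rlKernel ν (s - u) * f u := fun s hs => by
    simp only [rlIntegral_eq_setIntegral_Ioi ν f hs.le, ← integral_const_mul, mul_assoc]
  have hnonpos : ∀ s ∉ Ioi (0 : ℝ),
      ∫ u in Ioi 0, rlKernel μ (t - s) * rlKernel ν (s - u) * f u = 0 := fun s hs => by
    refine setIntegral_eq_zero_of_forall_eq_zero fun u hu => ?_
    rw [rlKernel_of_nonpos ν (by linarith [notMem_Ioi.1 hs, mem_Ioi.1 hu]), mul_zero, zero_mul]
  calc rlIntegral μ (rlIntegral ν f) t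
      = ∫ s in Ioi 0, ∫ u in Ioi 0, rlKernel μ (t - s) * rlKernel ν (s - u) * f u := by
        rw [rlIntegral_eq_setIntegral_Ioi μ _ ht]
        exact setIntegral_congr_fun measurableSet_Ioi hinner
    _ = ∫ s, ∫ u in Ioi 0, rlKernel μ (t - s) * rlKernel ν (s - u) * f u :=
        setIntegral_eq_integral_of_forall_compl_eq_zero hnonpos
    _ = ∫ u in Ioi 0, ∫ s, rlKernel μ (t - s) * rlKernel ν (s - u) * f u :=
        integral_integral_swap (integrable_rlKernel_mul_rlKernel_mul hμ hν hf hint)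
    _ = ∫ u in Ioi 0, rlKernel (μ + ν) (t - u) * f u := by
        simp only [integral_mul_const, integral_rlKernel_sub_mul_rlKernel_sub hμ hν]
    _ = rlIntegral (μ + ν) f t := (rlIntegral_eq_setIntegral_Ioi _ _ ht).symm

lemma integrableOn_rlKernel_one_sub_mul {f : ℝ → ℝ} (ht : 0 ≤ t)
    (hf : IntervalIntegrable f volume 0 t) :
    IntegrableOn (fun u => rlKernel 1 (t - u) * f u) (Ioi 0) := by
  have hind : EqOn ((Ioo 0 t).indicator f) (fun u => rlKernel 1 (t - u) * f u) (Ioi 0) :=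
    fun u hu => by
      rcases lt_or_ge u t with hut | htu
      · simp only [indicator_of_mem (show u ∈ Ioo 0 t from ⟨hu, hut⟩),
          rlKernel_one (sub_pos.2 hut), one_mul]
      · simp only [indicator_of_notMem (show u ∉ Ioo 0 t from fun h => h.2.not_ge htu),
          rlKernel_of_nonpos 1 (sub_nonpos.2 htu), zero_mul]
  have hon : IntegrableOn f (Ioo 0 t) := (intervalIntegrable_iff_integrableOn_Ioo_of_le ht).1 hf
  exact ((integrable_indicator_iff measurableSet_Ioo).2 hon).integrableOn.congr_fun hind
    measurableSet_Ioi

lemma caputoDeriv_eq_rlIntegral_deriv (hν : ν ≠ 1) (f : ℝ → ℝ) (ht : 0 ≤ t) :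
    caputoDeriv ν f t = rlIntegral (1 - ν) (deriv f) t := by
  rw [caputoDeriv, if_neg hν, rlIntegral, ← intervalIntegral.integral_const_mul,
    intervalIntegral.integral_of_le ht, intervalIntegral.integral_of_le ht,
    integral_Ioc_eq_integral_Ioo, integral_Ioc_eq_integral_Ioo]
  refine setIntegral_congr_fun measurableSet_Ioo fun s hs => ?_
  simp only [rlKernel_of_pos _ (sub_pos.2 hs.2), show 1 - ν - 1 = -ν by ring,
    Real.rpow_neg (sub_pos.2 hs.2).le]
  ring

theorem rlIntegral_caputoDeriv (hν : 0 < ν) (hν1 : ν ≤ 1) (ht : 0 ≤ t) {f : ℝ → ℝ}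
    (hf : AbsolutelyContinuousOnInterval f 0 t) :
    rlIntegral ν (caputoDeriv ν f) t = f t - f 0 := by
  rw [← hf.integral_deriv_eq_sub, ← rlIntegral_one _ ht]
  rcases hν1.eq_or_lt with rfl | hν1
  · exact rlIntegral_congr ht fun s _ => if_pos rfl
  · have hint := integrableOn_rlKernel_one_sub_mul ht hf.intervalIntegrable_deriv
    rw [rlIntegral_congr ht fun s hs => caputoDeriv_eq_rlIntegral_deriv hν1.ne f hs,
      rlIntegral_rlIntegral hν (sub_pos.2 hν1) ht (measurable_deriv f) (by simpa using hint),
      add_sub_cancel]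

end FractionalCalculus

section Volterra

variable {ν c t : ℝ}

lemma abs_le_of_eq_const_mul_rlIntegral (hν : 0 < ν) {f : ℝ → ℝ} {T D : ℝ}
    (hD : ∀ t ∈ Icc 0 T, |f t| ≤ D) (hf : ∀ t ∈ Icc 0 T, f t = c * rlIntegral ν f t) (r : ℕ) :
    ∀ t ∈ Icc 0 T, |f t| ≤ D * |c| ^ r * (t ^ (ν * r) / Real.Gamma (ν * r + 1)) := by
  induction r with
  | zero => simpa using hD
  | succ r ih =>
    intro t ht
    have hcont : Continuous fun s : ℝ => D * |c| ^ r * (s ^ (ν * r) / Real.Gamma (ν * r + 1)) :=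
      ((Real.continuous_rpow_const (by positivity)).div_const _).const_mul _
    have hle := abs_rlIntegral_le hν ht.1 hcont fun s hs => ih s ⟨hs.1, hs.2.trans ht.2⟩
    rw [rlIntegral_const_mul, rlIntegral_rpow_div_Gamma hν (by positivity) ht.1] at hle
    calc |f t| = |c| * |rlIntegral ν f t| := by rw [hf t ht, abs_mul]
      _ ≤ |c| * (D * |c| ^ r * (t ^ (ν * r + ν) / Real.Gamma (ν * r + ν + 1))) := by gcongr
      _ = D * |c| ^ (r + 1) *
          (t ^ (ν * ((r + 1 : ℕ) : ℝ)) / Real.Gamma (ν * ((r + 1 : ℕ) : ℝ) + 1)) := by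
        rw [pow_succ, Nat.cast_succ, mul_add_one]
        ring

lemma eq_zero_of_eq_const_mul_rlIntegral (hν : 0 < ν) {f : ℝ → ℝ} {T : ℝ}
    (hcont : ContinuousOn f (Icc 0 T)) (hf : ∀ t ∈ Icc 0 T, f t = c * rlIntegral ν f t) :
    ∀ t ∈ Icc 0 T, f t = 0 := by
  intro t ht
  obtain ⟨D, hD⟩ := isCompact_Icc.exists_bound_of_continuousOn hcont
  have hlim := (summable_inv_Gamma_mul_pow hν (|c| * t ^ ν)).tendsto_atTop_zero.const_mul D
  rw [mul_zero] at hlim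
  refine abs_nonpos_iff.1 (ge_of_tendsto' hlim fun r => ?_)
  refine (abs_le_of_eq_const_mul_rlIntegral hν hD hf r t ht).trans_eq ?_
  rw [Real.rpow_mul ht.1, Real.rpow_natCast, mul_pow]
  ring

theorem eq_of_eq_add_const_mul_rlIntegral (hν : 0 < ν) {f g φ : ℝ → ℝ} (hfc : Continuous f)
    (hgc : Continuous g) (hf : ∀ t, 0 ≤ t → f t = φ t + c * rlIntegral ν f t)
    (hg : ∀ t, 0 ≤ t → g t = φ t + c * rlIntegral ν g t) (ht : 0 ≤ t) : f t = g t := by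
  have hsub : ∀ s, rlIntegral ν (fun u => f u + -1 * g u) s =
      rlIntegral ν f s - rlIntegral ν g s := fun s => by
    rw [rlIntegral_add hν hfc (hgc.const_mul _), rlIntegral_const_mul]
    ring
  have hzero := eq_zero_of_eq_const_mul_rlIntegral (T := t) (c := c)
    (f := fun u => f u + -1 * g u) hν (by fun_prop) (fun s hs => by
      rw [hsub, hf s hs.1, hg s hs.1]
      ring) t ⟨ht, le_rfl⟩
  linarith

/-- The Mittag-Leffler function `E_ν(z) = ∑ z ^ r / Γ(ν r + 1)`. -/
noncomputable def mittagLeffler (ν z : ℝ) : ℝ :=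
  ∑' r : ℕ, (Real.Gamma (ν * r + 1))⁻¹ * z ^ r

lemma continuous_const_mul_rpow (hν : 0 ≤ ν) (c : ℝ) : Continuous fun s : ℝ => c * s ^ ν :=
  (Real.continuous_rpow_const hν).const_mul c

lemma continuous_mittagLeffler (hν : 0 < ν) : Continuous (mittagLeffler ν) :=
  continuous_tsum_mul_pow (summable_inv_Gamma_mul_pow hν)

lemma continuous_mittagLeffler_const_mul_rpow (hν : 0 < ν) (c : ℝ) :
    Continuous fun s : ℝ => mittagLeffler ν (c * s ^ ν) :=
  (continuous_mittagLeffler hν).comp (continuous_const_mul_rpow hν.le c)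

lemma inv_Gamma_mul_const_mul_rpow_pow {s : ℝ} (hs : 0 ≤ s) (ν c : ℝ) (r : ℕ) :
    (Real.Gamma (ν * r + 1))⁻¹ * (c * s ^ ν) ^ r =
      c ^ r * (s ^ (ν * r) / Real.Gamma (ν * r + 1)) := by
  rw [Real.rpow_mul hs, Real.rpow_natCast, mul_pow]
  ring

theorem mittagLeffler_eq_one_add_rlIntegral (hν : 0 < ν) (ht : 0 ≤ t) (c : ℝ) :
    mittagLeffler ν (c * t ^ ν) =
      1 + c * rlIntegral ν (fun s => mittagLeffler ν (c * s ^ ν)) t := by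
  have hterm : ∀ r : ℕ, c * ∫ s in (0 : ℝ)..t, rlKernel ν (t - s) *
      ((Real.Gamma (ν * r + 1))⁻¹ * (c * s ^ ν) ^ r) =
      (Real.Gamma (ν * (r + 1 : ℕ) + 1))⁻¹ * (c * t ^ ν) ^ (r + 1) := fun r => by
    change c * rlIntegral ν _ t = _
    rw [rlIntegral_congr ht fun s hs => inv_Gamma_mul_const_mul_rpow_pow hs ν c r,
      rlIntegral_const_mul, rlIntegral_rpow_div_Gamma hν (by positivity) ht,
      inv_Gamma_mul_const_mul_rpow_pow ht, Nat.cast_succ, mul_add_one, pow_succ']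
    ring
  have hsum := (hasSum_intervalIntegral_mul_pow (summable_inv_Gamma_mul_pow hν)
    (intervalIntegrable_rlKernel_sub hν t) (continuous_const_mul_rpow hν.le c)).mul_left c
  simp_rw [hterm] at hsum
  rw [mittagLeffler, (summable_inv_Gamma_mul_pow hν (c * t ^ ν)).tsum_eq_zero_add, hsum.tsum_eq]
  simp [rlIntegral, mittagLeffler]

end Volterra

section BirthProcess

variable {ν s : ℝ} {lam : ℕ → ℝ} {n : ℕ}

/-- The partial fraction coefficient `1 / ∏_{l ≠ m} (λ_l - λ_m)`, where `1 ≤ l ≤ n`. -/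
noncomputable def birthWeight (lam : ℕ → ℝ) (n m : ℕ) : ℝ :=
  1 / ∏ l ∈ (Finset.Icc 1 n).erase m, (lam l - lam m)

/-- The state probabilities of the fractional nonlinear birth process; they vanish for `n = 0`. -/
noncomputable def birthSolution (ν : ℝ) (lam : ℕ → ℝ) (n : ℕ) (s : ℝ) : ℝ :=
  (∏ h ∈ Finset.Icc 1 (n - 1), lam h) *
    ∑ m ∈ Finset.Icc 1 n, birthWeight lam n m * mittagLeffler ν (-lam m * s ^ ν)

lemma birthSolution_zero (ν : ℝ) (lam : ℕ → ℝ) (s : ℝ) : birthSolution ν lam 0 s = 0 := by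
  rw [birthSolution, Finset.Icc_eq_empty (by omega), Finset.sum_empty, mul_zero]

lemma continuous_birthSolution (hν : 0 < ν) (lam : ℕ → ℝ) (n : ℕ) :
    Continuous (birthSolution ν lam n) :=
  (continuous_finsetSum _ fun m _ =>
    (continuous_mittagLeffler_const_mul_rpow hν (-lam m)).const_mul _).const_mul _

lemma sum_birthWeight_succ (hdist : Set.InjOn lam (Icc 1 (n + 1))) :
    ∑ m ∈ Finset.Icc 1 (n + 1), birthWeight lam (n + 1) m = if n = 0 then 1 else 0 := by
  have hinj : Set.InjOn (fun k => -lam k) (Finset.Icc 1 (n + 1) : Finset ℕ) := by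
    rw [Finset.coe_Icc]
    exact neg_injective.comp_injOn hdist
  -- The weights are the coefficients of `X ^ n` in the Lagrange basis polynomials.
  have hcoeff := Lagrange.coeff_eq_sum hinj (P := 1) (by
    rw [Polynomial.degree_one, Nat.card_Icc]
    exact_mod_cast n.succ_pos)
  rw [Nat.card_Icc, Nat.add_sub_cancel, Nat.add_sub_cancel, Polynomial.coeff_one] at hcoeff
  rw [hcoeff]
  refine Finset.sum_congr rfl fun m _ => ?_
  simp only [Polynomial.eval_one, birthWeight, neg_sub_neg]

lemma mul_birthWeight_succ (hdist : Set.InjOn lam (Icc 1 (n + 1))) {m : ℕ}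
    (hm : m ∈ Finset.Icc 1 n) :
    (lam (n + 1) - lam m) * birthWeight lam (n + 1) m = birthWeight lam n m := by
  rw [Finset.mem_Icc] at hm
  have hne : lam (n + 1) - lam m ≠ 0 := sub_ne_zero.2 fun heq => by
    have := hdist ⟨by omega, le_rfl⟩ ⟨hm.1, by omega⟩ heq
    omega
  have hset : (Finset.Icc 1 (n + 1)).erase m = insert (n + 1) ((Finset.Icc 1 n).erase m) := by
    ext l
    simp only [Finset.mem_erase, Finset.mem_Icc, Finset.mem_insert]
    omega
  rw [birthWeight, birthWeight, hset, Finset.prod_insert (by simp)]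
  field_simp

lemma rlIntegral_birthSolution (hν : 0 < ν) (lam : ℕ → ℝ) (n : ℕ) (s : ℝ) :
    rlIntegral ν (birthSolution ν lam n) s =
      (∏ h ∈ Finset.Icc 1 (n - 1), lam h) * ∑ m ∈ Finset.Icc 1 n, birthWeight lam n m *
        rlIntegral ν (fun s => mittagLeffler ν (-lam m * s ^ ν)) s := by
  unfold birthSolution
  simp only [rlIntegral_const_mul, rlIntegral_sum hν _ fun m =>
    (continuous_mittagLeffler_const_mul_rpow hν (-lam m)).const_mul (birthWeight lam n m)]

lemma mul_rlIntegral_birthSolution (hν : 0 < ν) (hdist : Set.InjOn lam (Icc 1 (n + 1))) (s : ℝ) :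
    lam n * rlIntegral ν (birthSolution ν lam n) s =
      (∏ h ∈ Finset.Icc 1 n, lam h) * ∑ m ∈ Finset.Icc 1 (n + 1),
        (lam (n + 1) - lam m) * birthWeight lam (n + 1) m *
          rlIntegral ν (fun s => mittagLeffler ν (-lam m * s ^ ν)) s := by
  rw [Finset.sum_Icc_succ_top (by omega), sub_self, zero_mul, zero_mul, add_zero,
    Finset.sum_congr rfl fun m hm => by rw [mul_birthWeight_succ hdist hm],
    rlIntegral_birthSolution hν]
  rcases n with _ | n
  · simp
  · rw [Nat.add_sub_cancel, Finset.prod_Icc_succ_top (by omega)]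
    ring

theorem birthSolution_succ_eq_add_rlIntegral (hν : 0 < ν)
    (hdist : Set.InjOn lam (Icc 1 (n + 1))) (hs : 0 ≤ s) :
    birthSolution ν lam (n + 1) s = (if n = 0 then 1 else 0) +
      lam n * rlIntegral ν (birthSolution ν lam n) s +
      -lam (n + 1) * rlIntegral ν (birthSolution ν lam (n + 1)) s := by
  have hinitial : (∏ h ∈ Finset.Icc 1 n, lam h) *
      ∑ m ∈ Finset.Icc 1 (n + 1), birthWeight lam (n + 1) m = if n = 0 then 1 else 0 := by
    rw [sum_birthWeight_succ hdist]
    split_ifs with hn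
    · simp [hn]
    · rw [mul_zero]
  rw [← hinitial, mul_rlIntegral_birthSolution hν hdist, rlIntegral_birthSolution hν,
    birthSolution, Nat.add_sub_cancel, mul_left_comm (-lam (n + 1)), ← mul_add, ← mul_add,
    Finset.mul_sum _ _ (-lam (n + 1)), ← Finset.sum_add_distrib, ← Finset.sum_add_distrib]
  congr 1
  refine Finset.sum_congr rfl fun m _ => ?_
  rw [mittagLeffler_eq_one_add_rlIntegral hν hs]
  ring

variable {Ω : Type*} [MeasurableSpace Ω] {P : Measure Ω} {N : ℝ≥0 → Ω → ℕ}

lemma stateProb_max_zero (P : Measure Ω) (N : ℝ≥0 → Ω → ℕ) (n : ℕ) (s : ℝ) :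
    stateProb P N n (max s 0) = stateProb P N n s := by
  rw [stateProb, stateProb, Real.toNNReal_of_nonneg (le_max_right s 0)]
  rfl

namespace IsFractionalBirthProcess

variable (h : IsFractionalBirthProcess ν lam P N)
include h

lemma stateProb_zero : stateProb P N 0 = 0 :=
  funext fun s => by rw [← stateProb_max_zero, h.prob_zero _ (le_max_right _ _), Pi.zero_apply]

lemma continuous_stateProb (n : ℕ) : Continuous (stateProb P N n) := by
  rcases Nat.eq_zero_or_pos n with rfl | hn
  · exact h.stateProb_zero ▸ continuous_zero
  have hon : ContinuousOn (stateProb P N n) (Ici 0) := fun s hs => by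
    have hs1 : 0 < s + 1 := add_pos_of_nonneg_of_pos hs one_pos
    have hIcc := (h.abs_cont n hn (s + 1) hs1).continuousOn
    rw [uIcc_of_le hs1.le] at hIcc
    refine (hIcc s ⟨hs, (lt_add_one s).le⟩).mono_of_mem_nhdsWithin ?_
    rw [← Ici_inter_Iic]
    exact inter_mem_nhdsWithin _ (Iic_mem_nhds (lt_add_one s))
  exact (hon.comp_continuous (continuous_id.max continuous_const) fun s =>
    le_max_right s 0).congr fun s => stateProb_max_zero P N n s

theorem stateProb_succ_eq_add_rlIntegral (hν : 0 < ν) (hν1 : ν ≤ 1) (n : ℕ) (hs : 0 ≤ s) :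
    stateProb P N (n + 1) s = (if n = 0 then 1 else 0) +
      lam n * rlIntegral ν (stateProb P N n) s +
      -lam (n + 1) * rlIntegral ν (stateProb P N (n + 1)) s := by
  have hn : 1 ≤ n + 1 := n.succ_pos
  have hac : AbsolutelyContinuousOnInterval (stateProb P N (n + 1)) 0 s :=
    (h.abs_cont _ hn _ (add_pos_of_nonneg_of_pos hs one_pos)).mono (by
      rw [uIcc_of_le hs, uIcc_of_le (by linarith)]
      exact Icc_subset_Icc_right (lt_add_one s).le)
  have hcaputo := rlIntegral_caputoDeriv hν hν1 hs hac
  rw [rlIntegral_congr_ae hs (h.evolution _ hn), Nat.add_sub_cancel,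
    rlIntegral_add hν ((h.continuous_stateProb _).const_mul _)
      ((h.continuous_stateProb _).const_mul _), rlIntegral_const_mul, rlIntegral_const_mul,
    h.initial _ hn] at hcaputo
  simp only [Nat.add_eq_right] at hcaputo
  linarith

theorem stateProb_eq_birthSolution (hν : 0 < ν) (hν1 : ν ≤ 1)
    (hdist : Set.InjOn lam (Icc 1 n)) (hs : 0 ≤ s) :
    stateProb P N n s = birthSolution ν lam n s := by
  induction n generalizing s with
  | zero => rw [h.stateProb_zero, birthSolution_zero, Pi.zero_apply]
  | succ n ih =>
    have hprev : ∀ u, 0 ≤ u → stateProb P N n u = birthSolution ν lam n u := fun u hu =>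
      ih (hdist.mono (Icc_subset_Icc_right n.le_succ)) hu
    refine eq_of_eq_add_const_mul_rlIntegral hν (h.continuous_stateProb _)
      (continuous_birthSolution hν lam _) (fun u hu => ?_)
      (fun u hu => birthSolution_succ_eq_add_rlIntegral hν hdist hu) hs
    rw [h.stateProb_succ_eq_add_rlIntegral hν hν1 n hu, rlIntegral_congr hu hprev]

end IsFractionalBirthProcess

end BirthProcess

section ExponentialDensity

variable {β ν t : ℝ}

lemma integral_mul_exp_neg_mul_rpow (hβ : 0 < β) (ht : 0 ≤ t) (a : ℝ) :
    ∫ s in (0 : ℝ)..t, β * Real.exp (-(β * s)) * s ^ a =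
      lowerGamma (a + 1) (β * t) / β ^ a := by
  have hsubst := intervalIntegral.mul_integral_comp_mul_left (a := 0) (b := t) (c := β)
    (f := fun u : ℝ => Real.exp (-u) * u ^ a)
  rw [lowerGamma, add_sub_cancel_right, ← mul_zero β, ← hsubst, mul_zero,
    ← intervalIntegral.integral_const_mul, ← intervalIntegral.integral_div]
  refine intervalIntegral.integral_congr fun s hs => ?_
  rw [uIcc_of_le ht] at hs
  have hβa := (Real.rpow_pos_of_pos hβ a).ne'
  rw [Real.mul_rpow hβ.le hs.1]
  field_simp

lemma integral_mul_exp_neg_mul_mittagLeffler (hβ : 0 < β) (hν : 0 < ν) (ht : 0 ≤ t) (c : ℝ) :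
    ∫ s in (0 : ℝ)..t, β * Real.exp (-(β * s)) * mittagLeffler ν (c * s ^ ν) =
      ∑' r : ℕ, lowerGamma (ν * r + 1) (β * t) / Real.Gamma (ν * r + 1) * (c / β ^ ν) ^ r := by
  have hdensity : Continuous fun s : ℝ => β * Real.exp (-(β * s)) := by fun_prop
  refine (hasSum_intervalIntegral_mul_pow (summable_inv_Gamma_mul_pow hν)
    (hdensity.intervalIntegrable 0 t) (continuous_const_mul_rpow hν.le c)).tsum_eq.symm.trans
    (tsum_congr fun r => ?_)
  have hterm : EqOn
      (fun s => β * Real.exp (-(β * s)) * ((Real.Gamma (ν * r + 1))⁻¹ * (c * s ^ ν) ^ r))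
      (fun s => c ^ r / Real.Gamma (ν * r + 1) * (β * Real.exp (-(β * s)) * s ^ (ν * r)))
      (uIcc 0 t) := fun s hs => by
    rw [uIcc_of_le ht] at hs
    simp only [inv_Gamma_mul_const_mul_rpow_pow hs.1]
    ring
  rw [intervalIntegral.integral_congr hterm, intervalIntegral.integral_const_mul,
    integral_mul_exp_neg_mul_rpow hβ ht, Real.rpow_mul hβ.le, Real.rpow_natCast, div_pow]
  ring

theorem integral_mul_exp_neg_mul_birthSolution (hβ : 0 < β) (hν : 0 < ν) (ht : 0 ≤ t)
    (lam : ℕ → ℝ) (n : ℕ) :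
    ∫ s in (0 : ℝ)..t, β * Real.exp (-(β * s)) * birthSolution ν lam n s =
      (∏ h ∈ Finset.Icc 1 (n - 1), lam h) * ∑ m ∈ Finset.Icc 1 n, birthWeight lam n m *
        ∑' r : ℕ, lowerGamma (ν * r + 1) (β * t) / Real.Gamma (ν * r + 1) *
          (-lam m / β ^ ν) ^ r := by
  have hint : ∀ m ∈ Finset.Icc 1 n, IntervalIntegrable
      (fun s => birthWeight lam n m *
        (β * Real.exp (-(β * s)) * mittagLeffler ν (-lam m * s ^ ν))) volume 0 t := fun m _ =>
    Continuous.intervalIntegrable (((by fun_prop : Continuous fun s : ℝ =>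
      β * Real.exp (-(β * s))).mul (continuous_mittagLeffler_const_mul_rpow hν _)).const_mul _) _ _
  simp_rw [← integral_mul_exp_neg_mul_mittagLeffler hβ hν ht,
    ← intervalIntegral.integral_const_mul (birthWeight lam n _)]
  rw [← intervalIntegral.integral_finsetSum hint, ← intervalIntegral.integral_const_mul]
  congr 1 with s
  simp only [birthSolution, Finset.mul_sum]
  exact Finset.sum_congr rfl fun m _ => by ring

end ExponentialDensity

section YuleProbabilities

/-- The probability that a homogeneous Yule process of rate `β` with `a + 1` individuals at time `0`
has `a + 1 + m` individuals at time `s`. -/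
noncomputable def yuleProb (β : ℝ) (a m : ℕ) (s : ℝ) : ℝ :=
  (a + m).choose a * Real.exp (-(β * (a + 1) * s)) * (1 - Real.exp (-(β * s))) ^ m

variable {β : ℝ}

lemma continuous_yuleProb (β : ℝ) (a m : ℕ) : Continuous (yuleProb β a m) := by
  unfold yuleProb
  fun_prop

lemma yuleProb_zero (β : ℝ) (a : ℕ) (s : ℝ) :
    yuleProb β a 0 s = Real.exp (-(β * (a + 1) * s)) := by
  simp [yuleProb]

lemma yuleProb_succ_zero (β : ℝ) (a m : ℕ) : yuleProb β a (m + 1) 0 = 0 := by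
  simp [yuleProb]

lemma exp_neg_mul_lt_one {t : ℝ} (hβ : 0 < β) (ht : 0 < t) : Real.exp (-(β * t)) < 1 :=
  Real.exp_lt_one_iff.2 (neg_neg_of_pos (mul_pos hβ ht))

lemma yuleProb_pos (hβ : 0 < β) (a m : ℕ) {s : ℝ} (hs : 0 < s) : 0 < yuleProb β a m s := by
  have hexp := sub_pos.2 (exp_neg_mul_lt_one hβ hs)
  have hchoose : 0 < (a + m).choose a := Nat.choose_pos (Nat.le_add_right a m)
  unfold yuleProb
  positivity

lemma yuleProb_nonneg (hβ : 0 ≤ β) (a m : ℕ) {s : ℝ} (hs : 0 ≤ s) : 0 ≤ yuleProb β a m s := by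
  have hexp : 0 ≤ 1 - Real.exp (-(β * s)) :=
    sub_nonneg.2 (Real.exp_le_one_iff.2 (neg_nonpos.2 (mul_nonneg hβ hs)))
  unfold yuleProb
  positivity

lemma hasDerivAt_yuleProb_succ (β : ℝ) (a m : ℕ) (s : ℝ) :
    HasDerivAt (yuleProb β a (m + 1))
      (β * (a + m + 1) * yuleProb β a m s - β * (a + m + 2) * yuleProb β a (m + 1) s) s := by
  have hexp (c : ℝ) : HasDerivAt (fun s => Real.exp (-(c * s))) (-c * Real.exp (-(c * s))) s :=
    (((hasDerivAt_id' s).const_mul c).fun_neg.exp).congr_deriv (by ring)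
  have hchoose : ((a + (m + 1)).choose a : ℝ) * (m + 1) = (a + m).choose a * (a + m + 1) := by
    have h := Nat.choose_mul_succ_eq (a + m) a
    rw [show a + m + 1 - a = m + 1 by omega] at h
    exact_mod_cast h.symm
  refine (((hexp (β * (a + 1))).const_mul _).mul
    (((hexp β).const_sub 1).fun_pow (m + 1))).congr_deriv ?_
  rw [yuleProb, yuleProb, Nat.add_sub_cancel]
  push_cast
  linear_combination β * Real.exp (-(β * (a + 1) * s)) * (1 - Real.exp (-(β * s))) ^ m * hchoose

/-- Splitting at the last birth before time `s`: the forward equation in integrated form. -/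
lemma integral_yuleProb_mul_exp (β : ℝ) (a m : ℕ) (s : ℝ) :
    ∫ u in (0 : ℝ)..s, β * (a + m + 1) * yuleProb β a m u *
      Real.exp (-(β * (a + m + 2) * (s - u))) = yuleProb β a (m + 1) s := by
  have hderiv : ∀ u ∈ uIcc 0 s, HasDerivAt
      (fun u => yuleProb β a (m + 1) u * Real.exp (-(β * (a + m + 2) * (s - u))))
      (β * (a + m + 1) * yuleProb β a m u * Real.exp (-(β * (a + m + 2) * (s - u)))) u :=
    fun u _ => by
      have hexp := (((hasDerivAt_id' u).const_sub s).const_mul (β * (a + m + 2))).fun_neg.exp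
      exact ((hasDerivAt_yuleProb_succ β a m u).mul hexp).congr_deriv (by ring)
  have hcont := continuous_yuleProb β a m
  rw [intervalIntegral.integral_eq_sub_of_hasDerivAt hderiv
    (Continuous.intervalIntegrable (by fun_prop) _ _), yuleProb_succ_zero]
  simp

lemma succ_mul_choose_mul_choose (a : ℕ) {k i : ℕ} (hi : i ≤ k) :
    (a + i + 1) * (a + i).choose a * (a + k + 1).choose (a + i + 1) =
      (k + 1) * (a + (k + 1)).choose a * k.choose i := by
  have hsub := Nat.choose_mul (n := a + k + 1) (k := a + i + 1) (s := a + 1) (by omega)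
  have hleft := Nat.add_one_mul_choose_eq (a + i) a
  have hright := Nat.choose_succ_right_eq (a + k + 1) a
  rw [show a + k + 1 - (a + 1) = k by omega, show a + i + 1 - (a + 1) = i by omega] at hsub
  rw [show a + k + 1 - a = k + 1 by omega] at hright
  calc (a + i + 1) * (a + i).choose a * (a + k + 1).choose (a + i + 1)
      = (a + 1) * ((a + k + 1).choose (a + i + 1) * (a + i + 1).choose (a + 1)) := by
        rw [hleft]; ring
    _ = (a + k + 1).choose (a + 1) * (a + 1) * k.choose i := by rw [hsub]; ring
    _ = (k + 1) * (a + (k + 1)).choose a * k.choose i := by rw [hright, ← add_assoc]; ring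

/-- The left side is the intensity of births at time `t - s` together with `k + 1` births in all,
so that, given `k + 1` births in `[0, t]`, the ages at time `t` of the newborn have the truncated
exponential density `β e^{-β s} / (1 - e^{-β t})`. -/
lemma sum_yuleProb_mul_yuleProb (hβ : 0 < β) {t : ℝ} (ht : 0 < t) (a k : ℕ) (s : ℝ) :
    ∑ i ∈ Finset.range (k + 1),
      β * (a + i + 1) * yuleProb β a i (t - s) * yuleProb β (a + i + 1) (k - i) s =
    (k + 1) * yuleProb β a (k + 1) t *
      (β * Real.exp (-(β * s)) / (1 - Real.exp (-(β * t)))) := by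
  have hne : 1 - Real.exp (-(β * t)) ≠ 0 := (sub_pos.2 (exp_neg_mul_lt_one hβ ht)).ne'
  set x := Real.exp (-(β * s)) with hx
  set y := Real.exp (-(β * (t - s))) with hy
  have hxy : Real.exp (-(β * t)) = x * y := by
    rw [hx, hy, ← Real.exp_add]
    ring_nf
  have hpow (c : ℕ) (r : ℝ) : Real.exp (-(β * (c + 1) * r)) = Real.exp (-(β * r)) ^ (c + 1) := by
    rw [← Real.exp_nat_mul]
    push_cast
    ring_nf
  have hterm (i : ℕ) (hi : i ∈ Finset.range (k + 1)) :
      β * (a + i + 1) * yuleProb β a i (t - s) * yuleProb β (a + i + 1) (k - i) s =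
        β * (k + 1) * (a + (k + 1)).choose a * (x * y) ^ (a + 1) * x *
          ((x * (1 - y)) ^ i * (1 - x) ^ (k - i) * k.choose i) := by
    have hik : i ≤ k := Nat.lt_succ_iff.1 (Finset.mem_range.1 hi)
    have hchoose : ((a + i + 1) * (a + i).choose a * (a + k + 1).choose (a + i + 1) : ℝ) =
        (k + 1) * (a + (k + 1)).choose a * k.choose i := by
      exact_mod_cast succ_mul_choose_mul_choose a hik
    rw [yuleProb, yuleProb, hpow, hpow, ← hx, ← hy, mul_pow x (1 - y),
      show a + i + 1 + (k - i) = a + k + 1 by omega]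
    linear_combination β * y ^ (a + 1) * (1 - y) ^ i * x ^ (a + i + 2) * (1 - x) ^ (k - i) * hchoose
  have hbinom : ∑ i ∈ Finset.range (k + 1), (x * (1 - y)) ^ i * (1 - x) ^ (k - i) * k.choose i =
      (1 - x * y) ^ k := by
    rw [← add_pow]
    ring_nf
  rw [Finset.sum_congr rfl hterm, ← Finset.mul_sum, hbinom, yuleProb, hpow, hxy]
  rw [hxy] at hne
  field_simp
  ring

lemma sum_ofReal_yuleProb_mul_yuleProb {t s : ℝ} (hβ : 0 < β) (ht : 0 < t) (a k : ℕ)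
    (hs : s ∈ Icc 0 t) :
    ∑ i ∈ Finset.range (k + 1), ENNReal.ofReal (β * (a + i + 1) * yuleProb β a i (t - s) *
        yuleProb β (a + i + 1) (k - i) s) =
      (k + 1 : ℕ) * ENNReal.ofReal (yuleProb β a (k + 1) t) *
        ENNReal.ofReal (β * Real.exp (-(β * s)) / (1 - Real.exp (-(β * t)))) := by
  have hyule := yuleProb_nonneg hβ.le a (k + 1) ht.le
  rw [← ENNReal.ofReal_natCast, ← ENNReal.ofReal_mul (by positivity),
    ← ENNReal.ofReal_mul (by positivity), Nat.cast_succ, ← sum_yuleProb_mul_yuleProb hβ ht,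
    ENNReal.ofReal_sum_of_nonneg]
  intro i _
  have hyule := yuleProb_nonneg hβ.le a i (sub_nonneg.2 hs.2)
  have hyule' := yuleProb_nonneg hβ.le (a + i + 1) (k - i) hs.1
  positivity

end YuleProbabilities

section Independence

variable {Ω : Type*} [MeasurableSpace Ω] {P : Measure Ω}
  {α γ : Type*} [MeasurableSpace α] [MeasurableSpace γ]

lemma lintegral_prodMk_of_indepFun [IsFiniteMeasure P] {X : Ω → α} {Y : Ω → γ}
    (hX : Measurable X) (hY : Measurable Y) (hXY : IndepFun X Y P) {f : α × γ → ℝ≥0∞}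
    (hf : Measurable f) :
    ∫⁻ ω, f (X ω, Y ω) ∂P = ∫⁻ x, ∫⁻ ω, f (x, Y ω) ∂P ∂P.map X := by
  have hprod := (indepFun_iff_map_prod_eq_prod_map_map hX.aemeasurable hY.aemeasurable).1 hXY
  rw [← lintegral_map hf (hX.prodMk hY), hprod, lintegral_prod _ hf.aemeasurable]
  exact lintegral_congr fun x => lintegral_map (hf.comp measurable_prodMk_left) hY

lemma setLIntegral_inter_of_indepFun {X : Ω → α} {Y : Ω → γ}
    (hX : Measurable X) (hY : Measurable Y) (hXY : IndepFun X Y P) {s : Set α} {u : Set γ}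
    (hs : MeasurableSet s) (hu : MeasurableSet u) {f : α → ℝ≥0∞} (hf : Measurable f) :
    ∫⁻ ω in X ⁻¹' s ∩ Y ⁻¹' u, f (X ω) ∂P = P (Y ⁻¹' u) * ∫⁻ ω in X ⁻¹' s, f (X ω) ∂P := by
  have hindicator (ω : Ω) : (X ⁻¹' s ∩ Y ⁻¹' u).indicator (fun ω => f (X ω)) ω =
      s.indicator f (X ω) * u.indicator 1 (Y ω) := by
    by_cases hωs : X ω ∈ s <;> by_cases hωu : Y ω ∈ u <;> simp [hωs, hωu]
  have hind := hXY.comp (hf.indicator hs) (measurable_one.indicator hu (f := (1 : γ → ℝ≥0∞)))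
  rw [← lintegral_indicator ((hX hs).inter (hY hu)), lintegral_congr hindicator,
    ← lintegral_indicator (hX hs), ← lintegral_indicator_one (hY hu), mul_comm]
  exact lintegral_mul_eq_lintegral_mul_lintegral_of_indepFun ((hf.indicator hs).comp hX)
    ((measurable_one.indicator hu).comp hY) hind

end Independence

section CreationTimes

variable {Ω : Type*}

/-- The event that exactly `k` webpages are created in `(0, t]`. -/
def pagesEvent (τ : ℕ → Ω → ℝ) (t : ℝ) (k : ℕ) : Set Ω :=
  {ω | creationTime τ k ω ≤ t ∧ t < creationTime τ (k + 1) ω}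

lemma creationTime_succ (τ : ℕ → Ω → ℝ) (k : ℕ) (ω : Ω) :
    creationTime τ (k + 1) ω = creationTime τ k ω + τ k ω :=
  Finset.sum_range_succ _ _

lemma creationTime_add (τ : ℕ → Ω → ℝ) (j m : ℕ) (ω : Ω) :
    creationTime τ (j + m) ω = creationTime τ j ω + creationTime (fun i => τ (j + i)) m ω :=
  Finset.sum_range_add _ _ _

variable {τ : ℕ → Ω → ℝ} {t : ℝ} {ω : Ω}

lemma mem_pagesEvent_add_iff {j m : ℕ} :
    ω ∈ pagesEvent τ t (j + m) ↔
      ω ∈ pagesEvent (fun i => τ (j + i)) (t - creationTime τ j ω) m := by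
  simp only [pagesEvent, mem_ofPred_eq, add_assoc j m 1, creationTime_add τ j, le_sub_iff_add_le',
    sub_lt_iff_lt_add']

lemma creationTime_mono (hτ : ∀ i, 0 ≤ τ i ω) : Monotone fun k => creationTime τ k ω :=
  monotone_nat_of_le_succ fun k => by
    rw [creationTime_succ]
    exact le_add_of_nonneg_right (hτ k)

lemma newPages_eq_of_mem_pagesEvent (hτ : ∀ i, 0 ≤ τ i ω) {k : ℕ}
    (hω : ω ∈ pagesEvent τ t k) : newPages τ t ω = k := by
  have hmono := creationTime_mono hτ
  have hset : {j | 1 ≤ j ∧ creationTime τ j ω ≤ t} = Finset.Icc 1 k := by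
    ext j
    rw [Finset.mem_coe, Finset.mem_Icc]
    refine and_congr_right fun _ => ⟨fun hj => ?_, fun hj => (hmono hj).trans hω.1⟩
    by_contra hkj
    exact ((hmono (not_le.1 hkj)).trans hj).not_gt hω.2
  rw [newPages, hset, ncard_coe_finset, Nat.card_Icc, Nat.add_sub_cancel]

lemma exists_mem_pagesEvent (ht : 0 ≤ t) (hpages : newPages τ t ω ≠ 0) :
    ∃ k, ω ∈ pagesEvent τ t k := by
  classical
  obtain ⟨j, hj⟩ := ((finite_of_ncard_ne_zero hpages).insert 0).exists_notMem
  simp only [mem_insert_iff, mem_ofPred_eq, not_or, not_and, not_le] at hj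
  have hlater : ∃ k, t < creationTime τ (k + 1) ω := by
    refine ⟨j - 1, ?_⟩
    rw [Nat.sub_one_add_one hj.1]
    exact hj.2 (Nat.one_le_iff_ne_zero.2 hj.1)
  refine ⟨Nat.find hlater, ?_, Nat.find_spec hlater⟩
  rcases hfind : Nat.find hlater with _ | k
  · simpa only [creationTime, Finset.range_zero, Finset.sum_empty] using ht
  · exact not_lt.1 (Nat.find_min hlater (hfind ▸ k.lt_succ_self))

lemma newPages_eq_iff (ht : 0 ≤ t) (hτ : ∀ i, 0 ≤ τ i ω) {k : ℕ} (hk : k ≠ 0) :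
    newPages τ t ω = k ↔ ω ∈ pagesEvent τ t k := by
  refine ⟨fun hpages => ?_, newPages_eq_of_mem_pagesEvent hτ⟩
  obtain ⟨m, hm⟩ := exists_mem_pagesEvent ht (hpages.trans_ne hk)
  rwa [← hpages, newPages_eq_of_mem_pagesEvent hτ hm]

variable [MeasurableSpace Ω]

lemma measurable_creationTime (hτ : ∀ i, Measurable (τ i)) (k : ℕ) :
    Measurable (creationTime τ k) :=
  Finset.measurable_fun_sum _ fun i _ => hτ i

lemma measurableSet_pagesEvent (hτ : ∀ i, Measurable (τ i)) (t : ℝ) (k : ℕ) :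
    MeasurableSet (pagesEvent τ t k) :=
  (measurableSet_le (measurable_creationTime hτ _) measurable_const).inter
    (measurableSet_lt measurable_const (measurable_creationTime hτ _))

end CreationTimes

section YuleProcess

variable {Ω : Type*} [MeasurableSpace Ω] {P : Measure Ω} {τ : ℕ → Ω → ℝ}

lemma indepFun_creationTime_tail (hτ : ∀ i, Measurable (τ i)) (hind : iIndepFun τ P) (j : ℕ) :
    IndepFun (creationTime τ j) (fun ω i => τ (j + i) ω) P := by
  have hle (i : ℕ) : MeasurableSpace.comap (τ i) inferInstance ≤ ‹MeasurableSpace Ω› :=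
    (hτ i).comap_le
  have hpast : Measurable[⨆ i ∈ Iio j, MeasurableSpace.comap (τ i) inferInstance]
      (creationTime τ j) :=
    Finset.measurable_fun_sum _ fun i hi => (comap_measurable (τ i)).mono
      (le_iSup₂_of_le i (Finset.mem_range.1 hi) le_rfl) le_rfl
  have hfuture : Measurable[⨆ i ∈ Ici j, MeasurableSpace.comap (τ i) inferInstance]
      (fun ω i => τ (j + i) ω) :=
    @measurable_pi_lambda _ _ _ (_) _ _ fun i => (comap_measurable (τ (j + i))).mono
      (le_iSup₂_of_le (j + i) (mem_Ici.2 (Nat.le_add_right j i)) le_rfl) le_rfl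
  have hdisjoint : Disjoint (Iio j) (Ici j) :=
    disjoint_left.2 fun _ hi hi' => (mem_Iio.1 hi).not_ge hi'
  exact indep_of_indep_of_le_left (indep_of_indep_of_le_right
    (indep_iSup_of_disjoint hle hind hdisjoint) hfuture.comap_le) hpast.comap_le

lemma setLIntegral_pagesEvent_add (hτ : ∀ i, Measurable (τ i)) (hind : iIndepFun τ P) (t : ℝ)
    (j m : ℕ) {f : ℝ → ℝ≥0∞} (hf : Measurable f) :
    ∫⁻ ω in pagesEvent τ t (j + m), f (creationTime τ j ω) ∂P =
      ∫⁻ u, f u * P (pagesEvent (fun i => τ (j + i)) (t - u) m) ∂P.map (creationTime τ j) := by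
  have := hind.isProbabilityMeasure
  let event : Set (ℝ × (ℕ → ℝ)) := {x | x.2 ∈ pagesEvent (fun i y => y i) (t - x.1) m}
  have hcreation (k : ℕ) : Measurable fun x : ℝ × (ℕ → ℝ) => creationTime (fun i y => y i) k x.2 :=
    (measurable_creationTime measurable_pi_apply k).comp measurable_snd
  have hevent : MeasurableSet event :=
    (measurableSet_le (hcreation m) (measurable_fst.const_sub t)).inter
      (measurableSet_lt (measurable_fst.const_sub t) (hcreation (m + 1)))
  have hsplit := lintegral_prodMk_of_indepFun (measurable_creationTime hτ j)
    (measurable_pi_lambda _ fun i => hτ (j + i)) (indepFun_creationTime_tail hτ hind j)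
    ((hf.comp measurable_fst).indicator hevent)
  rw [← lintegral_indicator (measurableSet_pagesEvent hτ t (j + m))]
  refine (lintegral_congr fun ω => ?_).trans (hsplit.trans (lintegral_congr fun u => ?_))
  · classical exact if_congr mem_pagesEvent_add_iff rfl rfl
  · exact lintegral_indicator_const (μ := P)
      (measurableSet_pagesEvent (fun i => hτ (j + i)) (t - u) m) (f u)

/-- The times `τ 0, τ 1, …` between the successive births of a homogeneous Yule process of rate `β`
that starts with `a + 1` individuals. -/
structure IsYuleHoldingTimes (β : ℝ) (a : ℕ) (τ : ℕ → Ω → ℝ) (P : Measure Ω) : Prop where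
  measurable : ∀ i, Measurable (τ i)
  law : ∀ i : ℕ, HasLaw (τ i) (expMeasure (β * (((a + i : ℕ) : ℝ) + 1))) P
  indep : iIndepFun τ P

/-- The density of the `m + 1`-st birth time of a homogeneous Yule process of rate `β` that starts
with `a + 1` individuals. -/
noncomputable def birthTimeDensity (β : ℝ) (a m : ℕ) : ℝ → ℝ≥0∞ :=
  (Ici 0).indicator fun s => ENNReal.ofReal (β * (a + m + 1) * yuleProb β a m s)

lemma measurable_birthTimeDensity (β : ℝ) (a m : ℕ) : Measurable (birthTimeDensity β a m) :=
  ((continuous_yuleProb β a m).measurable.const_mul _).ennreal_ofReal.indicator measurableSet_Ici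

lemma birthTimeDensity_lt_top (β : ℝ) (a m : ℕ) (s : ℝ) : birthTimeDensity β a m s < ∞ :=
  (indicator_le_self _ _ s).trans_lt ENNReal.ofReal_lt_top

lemma expMeasure_Ioi {c s : ℝ} (hc : 0 < c) (hs : 0 ≤ s) :
    expMeasure c (Ioi s) = ENNReal.ofReal (Real.exp (-(c * s))) := by
  have := isProbabilityMeasure_expMeasure hc
  have hcdf : (expMeasure c).real (Iic s) = 1 - Real.exp (-(c * s)) := by
    rw [← cdf_eq_real, cdf_expMeasure_eq hc, if_pos hs]
  rw [← ofReal_measureReal, ← compl_Iic, probReal_compl_eq_one_sub measurableSet_Iic, hcdf,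
    sub_sub_cancel]

lemma exponentialPDF_eq_birthTimeDensity (β : ℝ) (a : ℕ) :
    exponentialPDF (β * (a + 1)) = birthTimeDensity β a 0 := by
  funext s
  rcases lt_or_ge s 0 with hs | hs
  · rw [exponentialPDF_of_neg hs, birthTimeDensity, indicator_of_notMem (notMem_Ici.2 hs)]
  · rw [exponentialPDF_of_nonneg hs, birthTimeDensity, indicator_of_mem (mem_Ici.2 hs),
      yuleProb_zero, Nat.cast_zero, add_zero]

lemma birthTimeDensity_lconvolution_exponentialPDF {β : ℝ} (hβ : 0 ≤ β) (a m : ℕ) :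
    birthTimeDensity β a m ⋆ₗ[volume] exponentialPDF (β * (a + m + 2)) =
      birthTimeDensity β a (m + 1) := by
  funext s
  rw [lconvolution_def]
  have hintegrand (u : ℝ) :
      birthTimeDensity β a m u * exponentialPDF (β * (a + m + 2)) (-u + s) =
        (Icc 0 s).indicator (fun u => ENNReal.ofReal (β * (a + m + 2) * (β * (a + m + 1) *
          yuleProb β a m u * Real.exp (-(β * (a + m + 2) * (s - u)))))) u := by
    rcases lt_or_ge u 0 with hu | hu
    · rw [birthTimeDensity, indicator_of_notMem (notMem_Ici.2 hu), zero_mul,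
        indicator_of_notMem (notMem_Icc_of_lt hu)]
    rcases lt_or_ge s u with hus | hus
    · rw [exponentialPDF_of_neg (by linarith), mul_zero, indicator_of_notMem (notMem_Icc_of_gt hus)]
    have hyule := yuleProb_nonneg hβ a m hu
    rw [birthTimeDensity, indicator_of_mem (mem_Ici.2 hu), indicator_of_mem (mem_Icc.2 ⟨hu, hus⟩),
      exponentialPDF_of_nonneg (by linarith), ← ENNReal.ofReal_mul (by positivity),
      neg_add_eq_sub]
    ring_nf
  rw [lintegral_congr hintegrand, lintegral_indicator measurableSet_Icc]
  rcases lt_or_ge s 0 with hs | hs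
  · rw [Icc_eq_empty hs.not_ge, setLIntegral_empty, birthTimeDensity,
      indicator_of_notMem (notMem_Ici.2 hs)]
  have hcont := continuous_yuleProb β a m
  rw [← ofReal_integral_eq_lintegral_ofReal, integral_Icc_eq_integral_Ioc,
    ← intervalIntegral.integral_of_le hs, intervalIntegral.integral_const_mul,
    integral_yuleProb_mul_exp, birthTimeDensity, indicator_of_mem (mem_Ici.2 hs)]
  · push_cast
    ring_nf
  · exact (by fun_prop : Continuous _).integrableOn_Icc
  · refine (ae_restrict_iff' measurableSet_Icc).2 (Eventually.of_forall fun u hu => ?_)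
    have hyule := yuleProb_nonneg hβ a m hu.1
    simp only [Pi.zero_apply]
    positivity

namespace IsYuleHoldingTimes

variable {β : ℝ} {a : ℕ}

lemma tail (h : IsYuleHoldingTimes β a τ P) (j : ℕ) :
    IsYuleHoldingTimes β (a + j) (fun i => τ (j + i)) P where
  measurable i := h.measurable (j + i)
  law i := by simpa only [add_assoc] using h.law (j + i)
  indep := h.indep.precomp (add_right_injective j)

lemma hasLaw_creationTime_succ (h : IsYuleHoldingTimes β a τ P) (hβ : 0 < β) (m : ℕ) :
    HasLaw (creationTime τ (m + 1)) (volume.withDensity (birthTimeDensity β a m)) P := by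
  have := h.indep.isProbabilityMeasure
  induction m with
  | zero =>
    rw [← exponentialPDF_eq_birthTimeDensity]
    have hfirst : creationTime τ 1 = τ 0 := by
      funext ω
      exact Finset.sum_range_one _
    rw [zero_add, hfirst]
    exact h.law 0
  | succ m ih =>
    have hrate : β * (((a + (m + 1) : ℕ) : ℝ) + 1) = β * (a + m + 2) := by
      push_cast
      ring
    have hlast : HasLaw (τ (m + 1)) (volume.withDensity (exponentialPDF (β * (a + m + 2)))) P :=
      hrate ▸ h.law (m + 1)
    have := ih.isProbabilityMeasure_iff.1 ‹_›
    have := hlast.isProbabilityMeasure_iff.1 ‹_›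
    have hind : IndepFun (creationTime τ (m + 1)) (τ (m + 1)) P :=
      (indepFun_creationTime_tail h.measurable h.indep (m + 1)).comp measurable_id
        (measurable_pi_apply 0)
    have hsum := hind.hasLaw_fun_add ih hlast
    rw [conv_withDensity_eq_lconvolution (measurable_birthTimeDensity β a m)
      (g := exponentialPDF _) (measurable_exponentialPDFReal _).ennreal_ofReal,
      birthTimeDensity_lconvolution_exponentialPDF hβ.le] at hsum
    rwa [funext (creationTime_succ τ (m + 1))]

lemma ofReal_mul_measure_pagesEvent_zero (h : IsYuleHoldingTimes β a τ P) (hβ : 0 < β) (s : ℝ) :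
    ENNReal.ofReal (β * (a + 1)) * P (pagesEvent τ s 0) = exponentialPDF (β * (a + 1)) s := by
  have hlaw : HasLaw (τ 0) (expMeasure (β * (a + 1))) P := h.law 0
  have hevent : pagesEvent τ s 0 = {ω | 0 ≤ s ∧ s < τ 0 ω} := by
    simp only [pagesEvent, creationTime, zero_add, Finset.range_zero, Finset.sum_empty,
      Finset.sum_range_one]
  rw [hevent]
  rcases lt_or_ge s 0 with hs | hs
  · simp only [hs.not_ge, false_and, ofPred_false, measure_empty, mul_zero,
      exponentialPDF_of_neg hs]
  · simp only [hs, true_and]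
    rw [hlaw.measure_eq (p := fun x => s < x) (measurableSet_Ioi (a := s))]
    change _ * expMeasure (β * (a + 1)) (Ioi s) = _
    rw [expMeasure_Ioi (by positivity) hs, exponentialPDF_of_nonneg hs,
      ENNReal.ofReal_mul (p := β * (a + 1)) (by positivity)]

/-- Births occur at rate `β (a + m + 1)` as long as there are `a + 1 + m` individuals. -/
lemma ofReal_mul_measure_pagesEvent (h : IsYuleHoldingTimes β a τ P) (hβ : 0 < β) (m : ℕ) (s : ℝ) :
    ENNReal.ofReal (β * (a + m + 1)) * P (pagesEvent τ s m) = birthTimeDensity β a m s := by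
  cases m with
  | zero =>
    rw [← exponentialPDF_eq_birthTimeDensity, Nat.cast_zero, add_zero]
    exact h.ofReal_mul_measure_pagesEvent_zero hβ s
  | succ m =>
    have hexp (u : ℝ) : ENNReal.ofReal (β * (a + m + 2)) *
        P (pagesEvent (fun i => τ (m + 1 + i)) (-u + s) 0) =
          exponentialPDF (β * (a + m + 2)) (-u + s) := by
      have hnext := (h.tail (m + 1)).ofReal_mul_measure_pagesEvent_zero hβ (s - u)
      rwa [show β * (((a + (m + 1) : ℕ) : ℝ) + 1) = β * (a + m + 2) by push_cast; ring,
        ← neg_add_eq_sub] at hnext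
    have hsplit := setLIntegral_pagesEvent_add h.measurable h.indep s (m + 1) 0 measurable_one
    simp only [Pi.one_apply, setLIntegral_one, one_mul, add_zero, ← neg_add_eq_sub] at hsplit
    rw [show β * (a + ((m + 1 : ℕ) : ℝ) + 1) = β * (a + m + 2) by push_cast; ring, hsplit,
      ← lintegral_const_mul' _ _ ENNReal.ofReal_ne_top, lintegral_congr hexp,
      (h.hasLaw_creationTime_succ hβ m).map_eq, lintegral_withDensity_eq_lintegral_mul _
        (measurable_birthTimeDensity β a m) (by unfold exponentialPDF; fun_prop),
      ← birthTimeDensity_lconvolution_exponentialPDF hβ.le, lconvolution_def]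
    rfl

lemma measure_pagesEvent (h : IsYuleHoldingTimes β a τ P) (hβ : 0 < β) (m : ℕ) {s : ℝ}
    (hs : 0 ≤ s) : P (pagesEvent τ s m) = ENNReal.ofReal (yuleProb β a m s) := by
  have hrate : 0 < β * (a + m + 1) := by positivity
  have hdensity := h.ofReal_mul_measure_pagesEvent hβ m s
  rw [birthTimeDensity, indicator_of_mem (mem_Ici.2 hs), ENNReal.ofReal_mul hrate.le] at hdensity
  exact (ENNReal.mul_right_inj (ENNReal.ofReal_pos.2 hrate).ne' ENNReal.ofReal_ne_top).1 hdensity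

lemma measure_pagesEvent_of_neg (h : IsYuleHoldingTimes β a τ P) (hβ : 0 < β) (m : ℕ) {s : ℝ}
    (hs : s < 0) : P (pagesEvent τ s m) = 0 := by
  have hrate : 0 < β * (a + m + 1) := by positivity
  have hdensity := h.ofReal_mul_measure_pagesEvent hβ m s
  rw [birthTimeDensity, indicator_of_notMem (notMem_Ici.2 hs)] at hdensity
  exact (mul_eq_zero.1 hdensity).resolve_left (ENNReal.ofReal_pos.2 hrate).ne'

lemma setLIntegral_pagesEvent_age (h : IsYuleHoldingTimes β a τ P) (hβ : 0 < β) (t : ℝ)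
    (i m : ℕ) {g : ℝ → ℝ≥0∞} (hg : Measurable g) :
    ∫⁻ ω in pagesEvent τ t (i + 1 + m), g (t - creationTime τ (i + 1) ω) ∂P =
      ∫⁻ s in Icc 0 t, ENNReal.ofReal
        (β * (a + i + 1) * yuleProb β a i (t - s) * yuleProb β (a + i + 1) m s) * g s := by
  have htail := h.tail (i + 1)
  have hintegrand (s : ℝ) : birthTimeDensity β a i (t - s) *
      (g s * P (pagesEvent (fun j => τ (i + 1 + j)) s m)) =
        (Icc 0 t).indicator (fun s => ENNReal.ofReal
          (β * (a + i + 1) * yuleProb β a i (t - s) * yuleProb β (a + i + 1) m s) * g s) s := by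
    rcases lt_or_ge s 0 with hs | hs
    · rw [htail.measure_pagesEvent_of_neg hβ m hs, mul_zero, mul_zero,
        indicator_of_notMem (notMem_Icc_of_lt hs)]
    rcases lt_or_ge t s with hst | hst
    · rw [birthTimeDensity, indicator_of_notMem (notMem_Ici.2 (sub_neg.2 hst)), zero_mul,
        indicator_of_notMem (notMem_Icc_of_gt hst)]
    have hyule := yuleProb_nonneg hβ.le a i (sub_nonneg.2 hst)
    rw [birthTimeDensity, indicator_of_mem (mem_Ici.2 (sub_nonneg.2 hst)),
      indicator_of_mem (mem_Icc.2 ⟨hs, hst⟩), htail.measure_pagesEvent hβ m hs,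
      ENNReal.ofReal_mul (p := β * (a + i + 1) * yuleProb β a i (t - s)) (by positivity),
      ← add_assoc]
    ring
  have hsplit := setLIntegral_pagesEvent_add h.measurable h.indep t (i + 1) m
    (hg.comp (measurable_id.const_sub t))
  simp only [Function.comp_apply, id_eq] at hsplit
  rw [hsplit, (h.hasLaw_creationTime_succ hβ i).map_eq,
    lintegral_withDensity_eq_lintegral_mul_non_measurable _ (measurable_birthTimeDensity β a i)
      (Eventually.of_forall (birthTimeDensity_lt_top β a i)),
    ← lintegral_sub_left_eq_self _ t, ← lintegral_indicator measurableSet_Icc]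
  simp only [Pi.mul_apply, sub_sub_cancel, hintegrand]

lemma sum_setLIntegral_pagesEvent_age (h : IsYuleHoldingTimes β a τ P) (hβ : 0 < β) {t : ℝ}
    (ht : 0 < t) (k : ℕ) {g : ℝ → ℝ≥0∞} (hg : Measurable g) :
    ∑ j ∈ Finset.Icc 1 k, ∫⁻ ω in pagesEvent τ t k, g (t - creationTime τ j ω) ∂P =
      k * P (pagesEvent τ t k) * ∫⁻ s in Icc 0 t,
        ENNReal.ofReal (β * Real.exp (-(β * s)) / (1 - Real.exp (-(β * t)))) * g s := by
  rcases k with _ | k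
  · simp
  have := h.indep.isProbabilityMeasure
  have hterm (i : ℕ) (hi : i ∈ Finset.range (k + 1)) :
      ∫⁻ ω in pagesEvent τ t (k + 1), g (t - creationTime τ (1 + i) ω) ∂P =
        ∫⁻ s in Icc 0 t, ENNReal.ofReal (β * (a + i + 1) * yuleProb β a i (t - s) *
          yuleProb β (a + i + 1) (k - i) s) * g s := by
    rw [← h.setLIntegral_pagesEvent_age hβ t i (k - i) hg, add_comm 1 i,
      show i + 1 + (k - i) = k + 1 by have := Finset.mem_range.1 hi; omega]
  have hmeas (i : ℕ) : Measurable fun s => ENNReal.ofReal (β * (a + i + 1) *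
      yuleProb β a i (t - s) * yuleProb β (a + i + 1) (k - i) s) * g s := by
    have hcont := continuous_yuleProb β a i
    have hcont' := continuous_yuleProb β (a + i + 1) (k - i)
    exact (by fun_prop : Continuous _).measurable.ennreal_ofReal.mul hg
  have hsum (s : ℝ) (hs : s ∈ Icc 0 t) :
      ∑ i ∈ Finset.range (k + 1), ENNReal.ofReal (β * (a + i + 1) * yuleProb β a i (t - s) *
          yuleProb β (a + i + 1) (k - i) s) * g s =
        (k + 1 : ℕ) * P (pagesEvent τ t (k + 1)) *
          (ENNReal.ofReal (β * Real.exp (-(β * s)) / (1 - Real.exp (-(β * t)))) * g s) := by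
    rw [h.measure_pagesEvent hβ (k + 1) ht.le, ← Finset.sum_mul, ← mul_assoc,
      sum_ofReal_yuleProb_mul_yuleProb hβ ht a k hs]
  rw [← Finset.Ico_add_one_right_eq_Icc, Finset.sum_Ico_eq_sum_range, Nat.add_sub_cancel,
    Finset.sum_congr rfl hterm, ← lintegral_finsetSum _ fun i _ => hmeas i,
    setLIntegral_congr_fun measurableSet_Icc hsum,
    lintegral_const_mul' _ _ (ENNReal.mul_ne_top (ENNReal.natCast_ne_top _) (measure_ne_top P _))]

end IsYuleHoldingTimes

end YuleProcess

section RandomTime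

open scoped Topology

/-- The least point `> s` of the grid `{1 / (m + 1), 2 / (m + 1), …}`: an approximation of `s` from
the right that takes only countably many values. -/
noncomputable def gridApprox (m : ℕ) (s : ℝ≥0) : ℝ≥0 :=
  ((⌊(m + 1) * s⌋₊ : ℝ≥0) + 1) / (m + 1)

lemma le_gridApprox (m : ℕ) (s : ℝ≥0) : s ≤ gridApprox m s := by
  rw [gridApprox, le_div_iff₀ (by positivity), mul_comm]
  exact (Nat.lt_floor_add_one _).le

lemma gridApprox_le (m : ℕ) (s : ℝ≥0) : gridApprox m s ≤ s + 1 / (m + 1) := by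
  rw [gridApprox, div_le_iff₀ (by positivity), add_mul s, one_div_mul_cancel (by positivity),
    mul_comm s]
  gcongr
  exact Nat.floor_le (by positivity)

lemma tendsto_gridApprox (s : ℝ≥0) : Tendsto (fun m => gridApprox m s) atTop (𝓝[≥] s) := by
  refine tendsto_nhdsWithin_iff.2 ⟨?_, Eventually.of_forall fun m => le_gridApprox m s⟩
  have hupper : Tendsto (fun m : ℕ => s + 1 / ((m : ℝ≥0) + 1)) atTop (𝓝 (s + 0)) :=
    tendsto_const_nhds.add tendsto_one_div_add_atTop_nhds_zero_nat
  rw [add_zero] at hupper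
  exact tendsto_of_tendsto_of_tendsto_of_le_of_le tendsto_const_nhds hupper
    (fun m => le_gridApprox m s) fun m => gridApprox_le m s

lemma eventually_gridApprox_eq {E : Type*} [TopologicalSpace E] [DiscreteTopology E]
    {f : ℝ≥0 → E} {s : ℝ≥0} (hf : ContinuousWithinAt f (Ici s) s) :
    ∀ᶠ m in atTop, f (gridApprox m s) = f s := by
  have hlim := hf.tendsto.comp (tendsto_gridApprox s)
  rwa [nhds_discrete, tendsto_pure] at hlim

variable {Ω : Type*} [MeasurableSpace Ω] {P : Measure Ω} {α E : Type*} [MeasurableSpace α]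
  [MeasurableSpace E]

lemma measurable_eval_of_countable {κ : Type*} [Countable κ] [MeasurableSpace κ]
    [DiscreteMeasurableSpace κ] : Measurable fun p : κ × (κ → E) => p.2 p.1 :=
  measurable_from_prod_countable_right fun i => measurable_pi_apply i

lemma measure_inter_eval_of_indepFun [IsFiniteMeasure P] {κ : Type*} [Countable κ]
    [MeasurableSpace κ] [DiscreteMeasurableSpace κ] {N : κ → Ω → E} (hN : ∀ i, Measurable (N i))
    {X : Ω → α} (hX : Measurable X) (hind : IndepFun X (fun ω i => N i ω) P) {T : α → κ}
    (hT : Measurable T) {C : Set α} (hC : MeasurableSet C) {B : Set E} (hB : MeasurableSet B) :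
    P {ω | X ω ∈ C ∧ N (T (X ω)) ω ∈ B} =
      ∫⁻ ω in X ⁻¹' C, P {ω' | N (T (X ω)) ω' ∈ B} ∂P := by
  have hpath : Measurable fun ω i => N i ω := measurable_pi_lambda _ hN
  let event : Set (α × (κ → E)) := {p | p.1 ∈ C ∧ p.2 (T p.1) ∈ B}
  have hevent : MeasurableSet event := (measurable_fst hC).inter
    ((measurable_eval_of_countable.comp
      ((hT.comp measurable_fst).prodMk measurable_snd)) hB)
  have hlaw : Measurable fun x => P {ω | N (T x) ω ∈ B} :=
    (measurable_of_countable fun i => P {ω | N i ω ∈ B}).comp hT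
  calc P {ω | X ω ∈ C ∧ N (T (X ω)) ω ∈ B}
      = ∫⁻ ω, event.indicator 1 (X ω, fun i => N i ω) ∂P :=
        (lintegral_indicator_one (hX.prodMk hpath hevent)).symm
    _ = ∫⁻ x, ∫⁻ ω, event.indicator 1 (x, fun i => N i ω) ∂P ∂P.map X :=
        lintegral_prodMk_of_indepFun hX hpath hind (measurable_one.indicator hevent)
    _ = ∫⁻ x, P {ω | x ∈ C ∧ N (T x) ω ∈ B} ∂P.map X :=
        lintegral_congr fun x => lintegral_indicator_one ((measurable_const.prodMk hpath) hevent)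
    _ = ∫⁻ x in C, P {ω | N (T x) ω ∈ B} ∂P.map X := by
        rw [← lintegral_indicator hC]
        refine lintegral_congr fun x => ?_
        by_cases hx : x ∈ C <;> simp [hx]
    _ = ∫⁻ ω in X ⁻¹' C, P {ω' | N (T (X ω)) ω' ∈ B} ∂P := setLIntegral_map hC hlaw hX

lemma measurable_eval_gridApprox {N : ℝ≥0 → Ω → E} (hN : ∀ s, Measurable (N s)) (m : ℕ)
    {S : Ω → ℝ≥0} (hS : Measurable S) : Measurable fun ω => N (gridApprox m (S ω)) ω :=
  measurable_eval_of_countable.comp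
    ((Nat.measurable_floor.comp (hS.const_mul ((m : ℝ≥0) + 1))).prodMk
      (measurable_pi_lambda _ fun i => hN (((i : ℝ≥0) + 1) / (m + 1))))

variable [TopologicalSpace E] [DiscreteTopology E]

lemma tendsto_measure_eval_gridApprox [IsFiniteMeasure P] {N : ℝ≥0 → Ω → E}
    (hN : ∀ s, Measurable (N s))
    (hright : ∀ ω s, ContinuousWithinAt (fun s => N s ω) (Ici s) s) {B : Set E}
    (hB : MeasurableSet B) (s : ℝ≥0) :
    Tendsto (fun m => P {ω | N (gridApprox m s) ω ∈ B}) atTop (𝓝 (P {ω | N s ω ∈ B})) := by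
  refine tendsto_measure_of_tendsto_indicator_of_isFiniteMeasure atTop P (fun m => hN _ hB)
    fun ω => ?_
  filter_upwards [eventually_gridApprox_eq (hright ω s)] with m hm
  rw [hm]

lemma measure_inter_eval_comp_of_indepFun [IsFiniteMeasure P] {N : ℝ≥0 → Ω → E}
    (hN : ∀ s, Measurable (N s))
    (hright : ∀ ω s, ContinuousWithinAt (fun s => N s ω) (Ici s) s)
    {X : Ω → α} (hX : Measurable X) (hind : IndepFun X (fun ω s => N s ω) P) {S : α → ℝ≥0}
    (hS : Measurable S) {C : Set α} (hC : MeasurableSet C) {B : Set E} (hB : MeasurableSet B) :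
    P {ω | X ω ∈ C ∧ N (S (X ω)) ω ∈ B} =
      ∫⁻ ω in X ⁻¹' C, P {ω' | N (S (X ω)) ω' ∈ B} ∂P := by
  have hgrid (m : ℕ) := measure_inter_eval_of_indepFun
    (fun i : ℕ => hN (((i : ℝ≥0) + 1) / (m + 1))) hX
    (hind.comp measurable_id (measurable_pi_lambda _ fun i : ℕ => measurable_pi_apply _))
    (Nat.measurable_floor.comp (hS.const_mul ((m : ℝ≥0) + 1))) hC hB
  have hevents : Tendsto (fun m => P {ω | X ω ∈ C ∧ N (gridApprox m (S (X ω))) ω ∈ B}) atTop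
      (𝓝 (P {ω | X ω ∈ C ∧ N (S (X ω)) ω ∈ B})) := by
    refine tendsto_measure_of_tendsto_indicator_of_isFiniteMeasure atTop P (fun m => ?_) fun ω => ?_
    · exact (hX hC).inter (measurable_eval_gridApprox hN m (hS.comp hX) hB)
    · filter_upwards [eventually_gridApprox_eq (hright ω (S (X ω)))] with m hm
      rw [hm]
  have hintegrals : Tendsto (fun m => ∫⁻ ω in X ⁻¹' C,
      P {ω' | N (gridApprox m (S (X ω))) ω' ∈ B} ∂P) atTop
      (𝓝 (∫⁻ ω in X ⁻¹' C, P {ω' | N (S (X ω)) ω' ∈ B} ∂P)) := by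
    refine tendsto_lintegral_of_dominated_convergence (fun _ => P univ) (fun m => ?_)
      (fun m => ae_of_all _ fun ω => measure_mono (subset_univ _)) ?_ (ae_of_all _ fun ω => ?_)
    · exact (measurable_of_countable fun i : ℕ =>
        P {ω' | N (((i : ℝ≥0) + 1) / (m + 1)) ω' ∈ B}).comp
          (Nat.measurable_floor.comp ((hS.comp hX).const_mul ((m : ℝ≥0) + 1)))
    · rw [lintegral_const]
      exact ENNReal.mul_ne_top (measure_ne_top _ _) (measure_ne_top _ _)
    · exact tendsto_measure_eval_gridApprox hN hright hB _
  exact tendsto_nhds_unique hevents (hintegrals.congr fun m => (hgrid m).symm)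

end RandomTime

section Model

lemma setOf_one_le_newPages {Ω : Type*} (τ : ℕ → Ω → ℝ) (t : ℝ) :
    {ω | 1 ≤ newPages τ t ω} = ⋃ k, {ω | newPages τ t ω = k + 1} := by
  ext ω
  simp only [mem_iUnion, mem_ofPred_eq]
  exact ⟨fun hω => ⟨newPages τ t ω - 1, (Nat.sub_add_cancel hω).symm⟩,
    fun ⟨k, hk⟩ => hk ▸ Nat.le_add_left 1 k⟩

variable {Ω : Type*} [MeasurableSpace Ω] {P : Measure Ω}

lemma IsYuleHoldingTimes.ae_nonneg {β : ℝ} {a : ℕ} {τ : ℕ → Ω → ℝ}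
    (h : IsYuleHoldingTimes β a τ P) : ∀ᵐ ω ∂P, ∀ i, 0 ≤ τ i ω := by
  refine ae_all_iff.2 fun i => ?_
  have hneg : P (τ i ⁻¹' Iio 0) = 0 := by
    rw [← Measure.map_apply (h.measurable i) measurableSet_Iio, (h.law i).map_eq, expMeasure,
      gammaMeasure, withDensity_apply _ measurableSet_Iio]
    exact lintegral_exponentialPDF_of_nonpos le_rfl
  filter_upwards [measure_eq_zero_iff_ae_notMem.1 hneg] with ω hω using not_lt.1 hω

lemma uniformOn_Icc_singleton {k j : ℕ} (hj : j ∈ Finset.Icc 1 k) :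
    uniformOn (Icc 1 k) ({j} : Set ℕ) = (k : ℝ≥0∞)⁻¹ := by
  have hcard := uniformOn_apply_finset (s := Finset.Icc 1 k) (t := {j})
  rw [Finset.inter_singleton_of_mem hj, Finset.coe_Icc, Finset.coe_singleton,
    Finset.card_singleton, Nat.card_Icc, Nat.add_sub_cancel, Nat.cast_one, one_div] at hcard
  exact hcard

lemma measure_eq_sum_fiber_inter {ι : Type*} [MeasurableSpace ι] [MeasurableSingletonClass ι]
    {J : Ω → ι} (hJ : Measurable J) {s : Finset ι} (hs : ∀ᵐ ω ∂P, J ω ∈ s) (E : Set Ω) :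
    P E = ∑ j ∈ s, P (J ⁻¹' {j} ∩ E) := by
  have hfiber (j : ι) : MeasurableSet (J ⁻¹' {j}) := hJ (measurableSet_singleton j)
  have hfull : P.restrict E (J ⁻¹' s) = P.restrict E univ :=
    measure_congr (eventuallyEq_univ.2 (ae_restrict_of_ae hs))
  simp only [← Measure.restrict_apply (hfiber _)]
  rw [sum_measure_preimage_singleton s fun j _ => hfiber j, hfull, Measure.restrict_apply_univ]

lemma measure_iUnion_inter_eq_mul {A : ℕ → Set Ω} {B : Set Ω} {c : ℝ≥0∞}
    (hA : ∀ k, NullMeasurableSet (A k) P) (hdisj : Pairwise fun i j => Disjoint (A i) (A j))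
    (hc : ∀ k, P (A k ∩ B) = P (A k) * c) : P ((⋃ k, A k) ∩ B) = P (⋃ k, A k) * c := by
  have hA' (k : ℕ) : NullMeasurableSet (A k) (P.restrict B) :=
    (hA k).mono_ac Measure.absolutelyContinuous_restrict
  have hd := hdisj.mono fun _ _ h => h.aedisjoint (μ := P)
  rw [measure_iUnion₀ hd hA, ← Measure.restrict_apply₀ (NullMeasurableSet.iUnion hA'),
    measure_iUnion₀ (hdisj.mono fun _ _ h => h.aedisjoint) hA', ← ENNReal.tsum_mul_right]
  exact tsum_congr fun k => (Measure.restrict_apply₀ (hA' k)).trans (hc k)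

namespace IsGeneralizedYuleModel

variable {β ν t : ℝ} {lam : ℕ → ℝ} {τ : ℕ → Ω → ℝ} {N : ℕ → ℝ≥0 → Ω → ℕ} {J : ℕ → Ω → ℕ}

lemma isYuleHoldingTimes (h : IsGeneralizedYuleModel β ν lam P τ N J) :
    IsYuleHoldingTimes β 0 τ P where
  measurable := h.measurable_time
  law i := by simpa only [zero_add] using h.law_time i
  indep := h.indep_time

lemma ae_choice_mem (h : IsGeneralizedYuleModel β ν lam P τ N J) {k : ℕ} (hk : 1 ≤ k) :
    ∀ᵐ ω ∂P, J k ω ∈ Finset.Icc 1 k := by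
  rw [(h.law_choice k hk).ae_iff (p := fun j => j ∈ Finset.Icc 1 k) (measurable_of_countable _)]
  filter_upwards [ae_cond_mem (μ := Measure.count) (measurableSet_Icc (a := 1) (b := k))]
    with j hj using Finset.mem_Icc.2 hj

lemma measure_choice_eq (h : IsGeneralizedYuleModel β ν lam P τ N J) {k j : ℕ} (hk : 1 ≤ k)
    (hj : j ∈ Finset.Icc 1 k) : P (J k ⁻¹' {j}) = (k : ℝ≥0∞)⁻¹ := by
  rw [← Measure.map_apply (h.measurable_choice k) (measurableSet_singleton j),
    (h.law_choice k hk).map_eq, uniformOn_Icc_singleton hj]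

lemma pagesEvent_ae_eq (h : IsGeneralizedYuleModel β ν lam P τ N J) (ht : 0 ≤ t) {k : ℕ}
    (hk : 1 ≤ k) : pagesEvent τ t k =ᵐ[P] {ω | newPages τ t ω = k} := by
  filter_upwards [h.isYuleHoldingTimes.ae_nonneg] with ω hω
  exact propext (newPages_eq_iff ht hω (Nat.one_le_iff_ne_zero.1 hk)).symm

lemma measure_newPages_eq_inter (h : IsGeneralizedYuleModel β ν lam P τ N J) (ht : 0 ≤ t) {k : ℕ}
    (hk : 1 ≤ k) (B : Set Ω) :
    P ({ω | newPages τ t ω = k} ∩ B) = P (pagesEvent τ t k ∩ B) :=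
  measure_congr (ae_eq_set_inter (h.pagesEvent_ae_eq ht hk).symm (ae_eq_refl B))

variable {n : ℕ} {p : ℝ≥0 → ℝ≥0∞}

lemma measure_pagesEvent_inter_choice_inter_inLinks [IsFiniteMeasure P]
    (h : IsGeneralizedYuleModel β ν lam P τ N J) (hp : Measurable p)
    (hN : ∀ j s, P {ω | N j s ω = n} = p s) (t : ℝ) {k j : ℕ} (hk : 1 ≤ k)
    (hj : j ∈ Finset.Icc 1 k) :
    P {ω | (ω ∈ pagesEvent τ t k ∧ J k ω = j) ∧ N j (t - creationTime τ j ω).toNNReal ω = n} =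
      (k : ℝ≥0∞)⁻¹ * ∫⁻ ω in pagesEvent τ t k, p (t - creationTime τ j ω).toNNReal ∂P := by
  have hτ : Measurable fun ω i => τ i ω := measurable_pi_lambda _ h.measurable_time
  have hJ : Measurable fun ω i => J i ω := measurable_pi_lambda _ h.measurable_choice
  let times : ℕ → (ℕ → ℝ) → ℝ := fun i x => x i
  have htimes : ∀ i, Measurable (times i) := measurable_pi_apply
  have hage : Measurable fun x => (t - creationTime times j x).toNNReal :=
    (measurable_const.sub (measurable_creationTime htimes j)).real_toNNReal
  have hpages := measurableSet_pagesEvent htimes t k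
  have hchoice : MeasurableSet {x : ℕ → ℕ | x k = j} :=
    (measurable_pi_apply (X := fun _ => ℕ) k) (measurableSet_singleton j)
  have hindep := (h.indep_birth_rest.comp (measurable_pi_apply j) measurable_id).symm
  calc _ = ∫⁻ ω in {ω | ω ∈ pagesEvent τ t k ∧ J k ω = j},
          P {ω' | N j (t - creationTime τ j ω).toNNReal ω' = n} ∂P :=
        measure_inter_eval_comp_of_indepFun (h.birth j).measurable (h.birth j).right_continuous
          (hτ.prodMk hJ) hindep (hage.comp measurable_fst) (hpages.prod hchoice)
          (measurableSet_singleton n)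
    _ = ∫⁻ ω in pagesEvent τ t k ∩ J k ⁻¹' {j}, p (t - creationTime τ j ω).toNNReal ∂P := by
        simp only [hN]
        rfl
    _ = P (J k ⁻¹' {j}) *
          ∫⁻ ω in pagesEvent τ t k, p (t - creationTime τ j ω).toNNReal ∂P :=
        setLIntegral_inter_of_indepFun hτ hJ h.indep_time_choice hpages hchoice (hp.comp hage)
    _ = _ := by rw [h.measure_choice_eq hk hj]

lemma measure_newPages_eq_inter_chosenSize_eq [IsFiniteMeasure P]
    (h : IsGeneralizedYuleModel β ν lam P τ N J) (hβ : 0 < β) (ht : 0 < t) (hp : Measurable p)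
    (hN : ∀ j s, P {ω | N j s ω = n} = p s) {k : ℕ} (hk : 1 ≤ k) :
    P ({ω | newPages τ t ω = k} ∩ {ω | chosenSize τ N J t ω = n}) =
      P {ω | newPages τ t ω = k} * ∫⁻ s in Icc 0 t,
        ENNReal.ofReal (β * Real.exp (-(β * s)) / (1 - Real.exp (-(β * t)))) * p s.toNNReal := by
  have hchosen {j : ℕ} : J k ⁻¹' {j} ∩
      ({ω | newPages τ t ω = k} ∩ {ω | chosenSize τ N J t ω = n}) =
      {ω | newPages τ t ω = k} ∩
        {ω | J k ω = j ∧ N j (t - creationTime τ j ω).toNNReal ω = n} := by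
    ext ω
    simp only [mem_inter_iff, mem_preimage, mem_singleton_iff, mem_ofPred_eq]
    constructor <;> (rintro ⟨rfl, rfl, hn⟩; exact ⟨rfl, rfl, hn⟩)
  have hterm (j : ℕ) (hj : j ∈ Finset.Icc 1 k) : P (J k ⁻¹' {j} ∩
      ({ω | newPages τ t ω = k} ∩ {ω | chosenSize τ N J t ω = n})) =
      (k : ℝ≥0∞)⁻¹ * ∫⁻ ω in pagesEvent τ t k, p (t - creationTime τ j ω).toNNReal ∂P := by
    rw [hchosen, h.measure_newPages_eq_inter ht.le hk,
      ← h.measure_pagesEvent_inter_choice_inter_inLinks hp hN t hk hj]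
    congr 1
    ext ω
    exact and_assoc.symm
  have hpages : P {ω | newPages τ t ω = k} = P (pagesEvent τ t k) := by
    simpa only [inter_univ] using h.measure_newPages_eq_inter ht.le hk univ
  rw [measure_eq_sum_fiber_inter (h.measurable_choice k) (h.ae_choice_mem hk),
    Finset.sum_congr rfl hterm, ← Finset.mul_sum,
    h.isYuleHoldingTimes.sum_setLIntegral_pagesEvent_age hβ ht k (g := fun s => p s.toNNReal)
      (hp.comp measurable_real_toNNReal), hpages, ← mul_assoc, ← mul_assoc,
    ENNReal.inv_mul_cancel (Nat.cast_ne_zero.2 (Nat.one_le_iff_ne_zero.1 hk))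
      (ENNReal.natCast_ne_top k), one_mul]

lemma nullMeasurableSet_newPages_eq (h : IsGeneralizedYuleModel β ν lam P τ N J) (ht : 0 ≤ t)
    {k : ℕ} (hk : 1 ≤ k) : NullMeasurableSet {ω | newPages τ t ω = k} P :=
  (measurableSet_pagesEvent h.measurable_time t k).nullMeasurableSet.congr
    (h.pagesEvent_ae_eq ht hk)

lemma nullMeasurableSet_one_le_newPages (h : IsGeneralizedYuleModel β ν lam P τ N J)
    (ht : 0 ≤ t) : NullMeasurableSet {ω | 1 ≤ newPages τ t ω} P := by
  rw [setOf_one_le_newPages]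
  exact NullMeasurableSet.iUnion fun k => h.nullMeasurableSet_newPages_eq ht (Nat.le_add_left 1 k)

lemma measure_one_le_newPages_ne_zero (h : IsGeneralizedYuleModel β ν lam P τ N J)
    (hβ : 0 < β) (ht : 0 < t) : P {ω | 1 ≤ newPages τ t ω} ≠ 0 := by
  have hone : P {ω | newPages τ t ω = 1} = ENNReal.ofReal (yuleProb β 0 1 t) := by
    rw [← measure_congr (h.pagesEvent_ae_eq ht.le le_rfl),
      h.isYuleHoldingTimes.measure_pagesEvent hβ 1 ht.le]
  have hpos : 0 < P {ω | newPages τ t ω = 1} := by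
    rw [hone]
    exact ENNReal.ofReal_pos.2 (yuleProb_pos hβ 0 1 ht)
  exact (hpos.trans_le (measure_mono fun ω hω => hω.ge)).ne'

lemma cond_chosenSize_eq [IsFiniteMeasure P] (h : IsGeneralizedYuleModel β ν lam P τ N J)
    (hβ : 0 < β) (ht : 0 < t) (hp : Measurable p) (hN : ∀ j s, P {ω | N j s ω = n} = p s) :
    cond P {ω | 1 ≤ newPages τ t ω} {ω | chosenSize τ N J t ω = n} = ∫⁻ s in Icc 0 t,
      ENNReal.ofReal (β * Real.exp (-(β * s)) / (1 - Real.exp (-(β * t)))) * p s.toNNReal := by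
  have hinter := measure_iUnion_inter_eq_mul (P := P) (B := {ω | chosenSize τ N J t ω = n})
    (fun k => h.nullMeasurableSet_newPages_eq ht.le (Nat.le_add_left 1 k))
    (fun i j hij => disjoint_left.2 fun ω hi hj => hij (Nat.succ_injective (hi.symm.trans hj)))
    fun k => h.measure_newPages_eq_inter_chosenSize_eq hβ ht hp hN (Nat.le_add_left 1 k)
  rw [← setOf_one_le_newPages] at hinter
  rw [ProbabilityTheory.cond, Measure.smul_apply, smul_eq_mul,
    Measure.restrict_apply₀' (h.nullMeasurableSet_one_le_newPages ht.le), inter_comm, hinter,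
    ← mul_assoc, ENNReal.inv_mul_cancel (h.measure_one_le_newPages_ne_zero hβ ht)
      (measure_ne_top _ _), one_mul]

lemma sizeProb_eq_integral [IsFiniteMeasure P] (h : IsGeneralizedYuleModel β ν lam P τ N J)
    (hβ : 0 < β) (hν : 0 < ν) (hν1 : ν ≤ 1) (ht : 0 < t) (hdist : Set.InjOn lam (Icc 1 n)) :
    sizeProb P τ N J t n = 1 / (1 - Real.exp (-(β * t))) *
      ∫ s in (0 : ℝ)..t, β * Real.exp (-(β * s)) * birthSolution ν lam n s := by
  have hexp : 0 < 1 - Real.exp (-(β * t)) := sub_pos.2 (exp_neg_mul_lt_one hβ ht)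
  have hsolution (j : ℕ) {s : ℝ} (hs : 0 ≤ s) :=
    (h.birth j).stateProb_eq_birthSolution (n := n) hν hν1 hdist hs
  have hlaw (j : ℕ) (s : ℝ≥0) :
      P {ω | N j s ω = n} = ENNReal.ofReal (birthSolution ν lam n s) := by
    rw [← hsolution j s.coe_nonneg, stateProb, Real.toNNReal_coe, ofReal_measureReal]
  have hmeas : Measurable fun s : ℝ≥0 => ENNReal.ofReal (birthSolution ν lam n s) :=
    ((continuous_birthSolution hν lam n).measurable.comp measurable_coe_nnreal_real).ennreal_ofReal
  have hdensity (s : ℝ) : 0 ≤ β * Real.exp (-(β * s)) / (1 - Real.exp (-(β * t))) := by positivity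
  rw [sizeProb, measureReal_def, h.cond_chosenSize_eq hβ ht hmeas hlaw,
    intervalIntegral.integral_of_le ht.le, ← integral_Icc_eq_integral_Ioc, ← integral_const_mul,
    integral_eq_lintegral_of_nonneg_ae]
  · congr 1
    refine setLIntegral_congr_fun measurableSet_Icc fun s hs => ?_
    simp only [Real.coe_toNNReal s hs.1]
    rw [← ENNReal.ofReal_mul (hdensity s)]
    ring_nf
  · refine (ae_restrict_iff' measurableSet_Icc).2 (ae_of_all _ fun s hs => ?_)
    have hsol : 0 ≤ birthSolution ν lam n s := hsolution 0 hs.1 ▸ measureReal_nonneg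
    simp only [Pi.zero_apply]
    positivity
  · have := continuous_birthSolution hν lam n
    exact (by fun_prop : Continuous _).aestronglyMeasurable

lemma sizeProb_eq_sum_birthWeight [IsFiniteMeasure P]
    (h : IsGeneralizedYuleModel β ν lam P τ N J) (hβ : 0 < β) (hν : 0 < ν) (hν1 : ν ≤ 1)
    (ht : 0 < t) (hdist : Set.InjOn lam (Icc 1 n)) :
    sizeProb P τ N J t n =
      1 / (1 - Real.exp (-(β * t))) * (∏ h ∈ Finset.Icc 1 (n - 1), lam h) *
        ∑ m ∈ Finset.Icc 1 n, birthWeight lam n m *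
          ∑' r : ℕ, lowerGamma (ν * r + 1) (β * t) / Real.Gamma (ν * r + 1) *
            (-(lam m) / β ^ ν) ^ r := by
  rw [h.sizeProb_eq_integral hβ hν hν1 ht hdist,
    integral_mul_exp_neg_mul_birthSolution hβ hν ht.le, mul_assoc]

end IsGeneralizedYuleModel

end Model

lemma inv_one_sub_neg_div {a b : ℝ} (hb : b ≠ 0) : (1 - -a / b)⁻¹ = b / (b + a) := by
  rw [neg_div, sub_neg_eq_add, one_add_div hb, inv_div]

theorem mainTheorem3 {Ω : Type*} [MeasurableSpace Ω] (P : Measure Ω) [IsProbabilityMeasure P]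
    (β ν t : ℝ) (hβ : 0 < β) (hν : 0 < ν) (hν1 : ν ≤ 1) (ht : 0 < t)
    (lam : ℕ → ℝ) (hlam : ∀ k, 1 ≤ k → 0 ≤ lam k) (hdist : Set.InjOn lam (Set.Ici 1))
    (τ : ℕ → Ω → ℝ) (N : ℕ → ℝ≥0 → Ω → ℕ) (J : ℕ → Ω → ℕ)
    (hmodel : IsGeneralizedYuleModel β ν lam P τ N J) :
    -- the explicit distribution, with lower incomplete gamma functions
    (∀ n : ℕ, 1 ≤ n →
      (∀ m ∈ Finset.Icc 1 n, Summable fun r : ℕ =>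
        lowerGamma (ν * r + 1) (β * t) / Real.Gamma (ν * r + 1) * (-(lam m) / β ^ ν) ^ r) ∧
      sizeProb P τ N J t n =
        1 / (1 - Real.exp (-(β * t))) * (∏ h ∈ Finset.Icc 1 (n - 1), lam h) *
          ∑ m ∈ Finset.Icc 1 n, 1 / (∏ l ∈ (Finset.Icc 1 n).erase m, (lam l - lam m)) *
            ∑' r : ℕ, lowerGamma (ν * r + 1) (β * t) / Real.Gamma (ν * r + 1) *
              (-(lam m) / β ^ ν) ^ r) ∧
    -- the form with upper incomplete gamma functions, where its series converge
    (∀ n : ℕ, 1 ≤ n → (∀ m ∈ Finset.Icc 1 n, lam m < β ^ ν) →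
      (∀ m ∈ Finset.Icc 1 n, Summable fun r : ℕ =>
        upperGamma (ν * r + 1) (β * t) / Real.Gamma (ν * r + 1) * (-(lam m) / β ^ ν) ^ r) ∧
      sizeProb P τ N J t n =
        1 / (1 - Real.exp (-(β * t))) * (∏ h ∈ Finset.Icc 1 (n - 1), lam h) *
          ∑ m ∈ Finset.Icc 1 n, 1 / (∏ l ∈ (Finset.Icc 1 n).erase m, (lam l - lam m)) *
            (β ^ ν / (β ^ ν + lam m) -
              ∑' r : ℕ, upperGamma (ν * r + 1) (β * t) / Real.Gamma (ν * r + 1) *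
                (-(lam m) / β ^ ν) ^ r)) ∧
    -- the same form for all rates, with the power series continued analytically to `ℂ ∖ {1}`
    (∃ G : ℂ → ℂ, DifferentiableOn ℂ G {1}ᶜ ∧
      (∀ z : ℂ, ‖z‖ < 1 → HasSum (fun r : ℕ =>
        ((upperGamma (ν * r + 1) (β * t) / Real.Gamma (ν * r + 1) : ℝ) : ℂ) * z ^ r) (G z)) ∧
      ∀ n : ℕ, 1 ≤ n →
        (sizeProb P τ N J t n : ℂ) =
          ((1 / (1 - Real.exp (-(β * t))) * (∏ h ∈ Finset.Icc 1 (n - 1), lam h) : ℝ) : ℂ) *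
            ∑ m ∈ Finset.Icc 1 n,
              ((1 / (∏ l ∈ (Finset.Icc 1 n).erase m, (lam l - lam m)) : ℝ) : ℂ) *
                (((β ^ ν / (β ^ ν + lam m) : ℝ) : ℂ) -
                  G ((-(lam m) / β ^ ν : ℝ) : ℂ))) := by
  have hx : 0 ≤ β * t := by positivity
  have hβν : 0 < β ^ ν := by positivity
  have hsize (n : ℕ) := hmodel.sizeProb_eq_sum_birthWeight hβ hν hν1 ht
    (hdist.mono (Icc_subset_Ici_self : Icc 1 n ⊆ Ici 1))
  refine ⟨fun n _ => ⟨fun m _ => summable_lowerGamma_div_Gamma_mul_pow hν hx _, hsize n⟩,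
    fun n _ hlt => ?_, upperGammaContinuation ν (β * t),
    differentiableOn_upperGammaContinuation hν hx,
    fun z => hasSum_upperGammaContinuation hν hx, fun n _ => ?_⟩
  · have hratio (m : ℕ) (hm : m ∈ Finset.Icc 1 n) : |-(lam m) / β ^ ν| < 1 := by
      rw [abs_div, abs_neg, abs_of_nonneg (hlam m (Finset.mem_Icc.1 hm).1), abs_of_pos hβν,
        div_lt_one hβν]
      exact hlt m hm
    refine ⟨fun m hm => summable_upperGamma_div_Gamma_mul_pow hν.le hx (hratio m hm), ?_⟩
    refine (hsize n).trans (congrArg _ (Finset.sum_congr rfl fun m hm => ?_))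
    rw [tsum_lowerGamma_div_Gamma_mul_pow hν.le hx (hratio m hm), inv_one_sub_neg_div hβν.ne',
      birthWeight]
  · rw [hsize n, Complex.ofReal_mul, Complex.ofReal_sum]
    refine congrArg _ (Finset.sum_congr rfl fun m _ => ?_)
    rw [Complex.ofReal_mul, ofReal_tsum_lowerGamma_div_Gamma_mul_pow, inv_one_sub_neg_div hβν.ne',
      birthWeight]
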